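/- Let $\mathbb F$ be one of $\mathbb R,\mathbb C,\mathbb H$, $d=\dim_{\mathbb R}\mathbb F\in\{1,2,4\}$, $q\ge 2$ an integer, $G=GL(q,\mathbb F)$ and $K=U(q,\mathbb F)$ with normalized Haar measure $du$. For $g\in G$ let $\ln\sigma_{sing}(g)\in\mathbb R^q$ be the vector of the logarithms of the singular values of $g$ (the square roots of the eigenvalues of $g^*g$), in decreasing order. For a positive definite Hermitian $q\times q$ matrix $x$ over $\mathbb F$ let $\Delta_r(x)$ be its $r$-th leading principal minor (for $\mathbb F=\mathbb H$ with the Dieudonné determinant $\det=(\det_{\mathbb C})^{1/2}$), and for $\lambda\in\mathbb C^q$ put $\Delta_\lambda(x)=\Delta_1(x)^{\lambda_1-\lambda_2}\cdots\Delta_{q-1}(x)^{\lambda_{q-1}-\lambda_q}\Delta_q(x)^{\lambda_q}$. Let $\rho_l=\frac d2(q+1-2l)$ for $l=1,\dots,q$, and let $$\varphi_\lambda(t)=\int_K\Delta_{(i\lambda-\rho)/2}\bigl(u^{-1}\,\mathrm{diag}(e^{2t_1},\dots,e^{2t_q})\,u\bigr)\,du\qquad(t\in\mathbb R^q,\ \lambda\in\mathbb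 C^q)$$ be the spherical functions. Define the moment functions $$m_{\mathbf 1}(t)=\Bigl(\tfrac{\partial}{\partial\lambda_j}\varphi_{-i\rho-i\lambda}(t)\big|_{\lambda=0}\Bigr)_{j=1,\dots,q},\qquad m_{\mathbf 2}(t)=\Bigl(\tfrac{\partial^2}{\partial\lambda_j\partial\lambda_l}\varphi_{-i\rho-i\lambda}(t)\big|_{\lambda=0}\Bigr)_{j,l=1,\dots,q}.$$ Let $X_1,X_2,\dots$ be i.i.d. $G$-valued random variables whose common law $\nu_G$ is $K$-biinvariant, let $S_k=X_1X_2\cdots X_k$ (with $S_0=I_q$), and let $\nu$ be the image of $\nu_G$ under $\ln\sigma_{sing}$, a probability measure on $\{t\in\mathbb R^q: t_1\ge\cdots\ge t_q\}$. Suppose that $\nu$ admits second moments, i.e. $\int t_j^2\,d\nu(t)<\infty$ for $j=1,\dots,q$. Then $m_{\mathbf 1}$ and all entries of $m_{\mathbf 2}$ are $\nu$-integrable; with the row vector $$m_{\mathbf 1}(\nu)=\int m_{\mathbf 1}\,d\nu\qquad\text{and the matrix}\qquad \Sigma^2(\nu)=\int m_{\mathbf 2}\,d\nu-m_{\mathbf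 1}(\nu)^t\,m_{\mathbf 1}(\nu),$$ the matrix $\Sigma^2(\nu)$ is positive semidefinite, and for $k\to\infty$ $$\frac1{\sqrt k}\bigl(\ln\sigma_{sing}(S_k)-k\cdot m_{\mathbf 1}(\nu)\bigr)\longrightarrow N(0,\Sigma^2(\nu))\qquad\text{in distribution}.$$ -/

import Mathlib

open MeasureTheory ProbabilityTheory Matrix Filter
open scoped ENNReal Topology

noncomputable section

namespace BiinvariantWalk

variable (F : Type*) [NormedDivisionRing F] [NormedAlgebra ℝ F] [StarRing F] [CStarRing F]

/-- `F` is one of the (skew-)fields `ℝ`, `ℂ`, `ℍ`, as a real algebra with conjugation. -/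
def IsRealComplexOrQuaternion : Prop :=
  Nonempty (F ≃⋆ₐ[ℝ] ℝ) ∨ Nonempty (F ≃⋆ₐ[ℝ] ℂ) ∨ Nonempty (F ≃⋆ₐ[ℝ] Quaternion ℝ)

/-- The unitary group `U(q, F)` of all `u` with `u* u = u u* = 1`. -/
abbrev U (q : ℕ) := unitary (Matrix (Fin q) (Fin q) F)

variable {F}

/-- `GL(q, F)` and `U(q, F)` carry their Borel σ-algebras. -/
instance instMeasurableSpaceGL (q : ℕ) : MeasurableSpace (GL (Fin q) F) := borel _

instance instBorelSpaceGL (q : ℕ) : BorelSpace (GL (Fin q) F) := ⟨rfl⟩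

instance instMeasurableSpaceU (q : ℕ) : MeasurableSpace (U F q) := borel _

instance instBorelSpaceU (q : ℕ) : BorelSpace (U F q) := ⟨rfl⟩

instance instLocallyCompactSpaceU [FiniteDimensional ℝ F] (q : ℕ) :
    LocallyCompactSpace (U F q) := by
  have : ProperSpace F := FiniteDimensional.proper_real F
  have : LocallyCompactSpace (Matrix (Fin q) (Fin q) F) :=
    inferInstanceAs (LocallyCompactSpace (Fin q → Fin q → F))
  exact (isClosed_unitary
    (R := Matrix (Fin q) (Fin q) F)).isClosedEmbedding_subtypeVal.locallyCompactSpace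

variable (F) in
/-- The normalized Haar measure `du` on the compact group `U(q, F)`. -/
def haarU [FiniteDimensional ℝ F] (q : ℕ) : Measure (U F q) :=
  ((Measure.haar : Measure (U F q)) Set.univ)⁻¹ • Measure.haar

/-- The matrix `A` acting on the column space `F^n`, viewed as a real vector space of
dimension `n * dim_ℝ F`. -/
def realLin {n : Type*} [Fintype n] (A : Matrix n n F) : (n → F) →ₗ[ℝ] (n → F) where
  toFun v := A *ᵥ v
  map_add' v w := Matrix.mulVec_add A v w
  map_smul' c v := Matrix.mulVec_smul A c v

/-- The eigenvalues of a Hermitian matrix `A` over `F`, in decreasing order and counted with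
multiplicity over `F`. As an eigenvalue of the real operator `realLin A`, an eigenvalue of `A`
has `d = dim_ℝ F` times its multiplicity over `F`, so every `d`-th one is taken. -/
def eigenvalues [FiniteDimensional ℝ F] {q : ℕ} (A : Matrix (Fin q) (Fin q) F) (j : Fin q) : ℝ :=
  ((realLin A).charpoly.roots.sort (· ≥ ·)).getD (Module.finrank ℝ F * j) 0

/-- The singular spectrum of `g`: the square roots of the eigenvalues of `g* g`, in decreasing
order. -/
def singularSpectrum [FiniteDimensional ℝ F] {q : ℕ} (g : GL (Fin q) F) (j : Fin q) : ℝ :=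
  √(eigenvalues ((g : Matrix (Fin q) (Fin q) F)ᴴ * (g : Matrix (Fin q) (Fin q) F)) j)

/-- The map `ln σ_sing` from `GL(q, F)` to (the Weyl chamber in) `ℝ^q`. -/
def logSing [FiniteDimensional ℝ F] {q : ℕ} (g : GL (Fin q) F) : EuclideanSpace ℝ (Fin q) :=
  WithLp.toLp 2 fun j => Real.log (singularSpectrum g j)

/-- Determinant of a positive definite Hermitian matrix over `F` (the product of its eigenvalues).
The real determinant is its `d`-th power, `d = dim_ℝ F`; so this is the usual determinant for
`ℝ` and `ℂ`, and the Dieudonné determinant `(det_ℂ A)^(1/2)` for `ℍ`. -/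
def hermDet {n : Type*} [Fintype n] (A : Matrix n n F) : ℝ :=
  (LinearMap.det (realLin A)) ^ (1 / (Module.finrank ℝ F : ℝ))

/-- The principal minor of `A` on the rows and columns with (0-based) index at most `r`, which is
`Δ_{r+1}(A)` in 1-based numbering. -/
def minor {q : ℕ} (A : Matrix (Fin q) (Fin q) F) (r : Fin q) : ℝ :=
  hermDet (A.submatrix (Subtype.val : {i // i ≤ r} → Fin q) Subtype.val)

/-- The power function
`Δ_λ(x) = Δ_1(x)^(λ_1 - λ_2) ⋯ Δ_{q-1}(x)^(λ_{q-1} - λ_q) Δ_q(x)^λ_q`. -/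
def powerFun {q : ℕ} (lam : Fin q → ℂ) (x : Matrix (Fin q) (Fin q) F) : ℂ :=
  ∏ r : Fin q,
    (minor x r : ℂ) ^ (lam r - if h : (r : ℕ) + 1 < q then lam ⟨(r : ℕ) + 1, h⟩ else 0)

variable (F)

/-- The half sum of positive roots, `ρ_l = (d/2) (q + 1 - 2 l)` for `l = 1, …, q`. -/
def rho (q : ℕ) (l : Fin q) : ℝ :=
  (Module.finrank ℝ F : ℝ) / 2 * ((q : ℝ) + 1 - 2 * ((l : ℝ) + 1))

/-- The diagonal matrix `e^{2t}`. -/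
def expDiag {q : ℕ} (t : EuclideanSpace ℝ (Fin q)) : Matrix (Fin q) (Fin q) F :=
  Matrix.diagonal fun i => algebraMap ℝ F (Real.exp (2 * t i))

variable [FiniteDimensional ℝ F]

/-- The spherical function `φ_λ` of `(GL(q, F), U(q, F))`, through the Harish-Chandra integral
`φ_λ(t) = ∫ Δ_{(iλ - ρ)/2}(u⁻¹ e^{2t} u) du`. -/
def spherical {q : ℕ} (lam : Fin q → ℂ) (t : EuclideanSpace ℝ (Fin q)) : ℂ :=
  ∫ u : U F q, powerFun (fun l => (Complex.I * lam l - (rho F q l : ℂ)) / 2)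
    (((u⁻¹ : U F q) : Matrix (Fin q) (Fin q) F) * expDiag F t *
      (u : Matrix (Fin q) (Fin q) F)) ∂(haarU F q)

/-- The moment function `∂_{j_1} ⋯ ∂_{j_n} φ_{-iρ-iλ}(t)` at `λ = 0`, with partial derivatives in
the real spectral variables `λ_1, …, λ_q`. It is `m_l(t)` for the multiindex `l` that counts how
often each index occurs in the list. -/
def momentFun {q : ℕ} (js : List (Fin q)) (t : EuclideanSpace ℝ (Fin q)) : ℝ :=
  (js.foldr (fun j f lam => lineDeriv ℝ f lam (Pi.single j 1))
    (fun lam : Fin q → ℝ =>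
      spherical F (fun l => -Complex.I * (rho F q l : ℂ) - Complex.I * (lam l : ℂ)) t) 0).re

/-- The vector `m_1(t)` of moment functions of first order. -/
def m1 {q : ℕ} (t : EuclideanSpace ℝ (Fin q)) : EuclideanSpace ℝ (Fin q) :=
  WithLp.toLp 2 fun j => momentFun F [j] t

/-- The matrix `m_2(t)` of moment functions of second order. -/
def m2 {q : ℕ} (t : EuclideanSpace ℝ (Fin q)) : Matrix (Fin q) (Fin q) ℝ :=
  Matrix.of fun j l => momentFun F [j, l] t

/-- The dispersion `m_1(ν) = ∫ m_1 dν`. -/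
def dispersion {q : ℕ} (ν : Measure (EuclideanSpace ℝ (Fin q))) : EuclideanSpace ℝ (Fin q) :=
  ∫ t, m1 F t ∂ν

/-- The modified covariance matrix `Σ²(ν) = ∫ m_2 dν - m_1(ν)ᵗ m_1(ν)`. -/
def modCov {q : ℕ} (ν : Measure (EuclideanSpace ℝ (Fin q))) : Matrix (Fin q) (Fin q) ℝ :=
  Matrix.of fun j l => (∫ t, m2 F t j l ∂ν) - dispersion F ν j * dispersion F ν l

end BiinvariantWalk

namespace BiinvariantWalk

variable {F : Type*} [NormedDivisionRing F] [StarRing F]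

/-- `ν` is invariant under left and right multiplication with elements of `U(q, F)`. -/
def IsBiinvariant {q : ℕ} (ν : Measure (GL (Fin q) F)) : Prop :=
  ∀ u : U F q, ν.map (fun g => Unitary.toUnits u * g) = ν ∧
    ν.map (fun g => g * Unitary.toUnits u) = ν

/-- The random walk `S_k = X_1 ⋯ X_k` with `S_0 = 1`, for increments numbered from `0`
(`X 0` is `X_1`, and so on). -/
def walk {Ω : Type*} {q : ℕ} (X : ℕ → Ω → GL (Fin q) F) : ℕ → Ω → GL (Fin q) F
  | 0, _ => 1
  | k + 1, ω => walk X k ω * X k ω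

end BiinvariantWalk

end

open BiinvariantWalk

set_option linter.unusedSectionVars false

noncomputable section

namespace BiinvariantWalk

/-! ### Arithmetic of the three scalar (skew-)fields -/

section Scalars

variable {F : Type*} [NormedDivisionRing F] [NormedAlgebra ℝ F] [StarRing F] [CStarRing F]
  [hF : Fact (IsRealComplexOrQuaternion F)]

/-! The idea is to replace the singular spectrum by the Iwasawa projection, which turns the walk
into a sum of i.i.d. vectors. Write `g = kτ` with `k` unitary and `τ` upper triangular; then the
leading minors of `g* g = τ* τ` are the products of the `|τ_ii|²`, and `iwasawa g` is the vector of
the `log |τ_ii|`. If `x = κτ`, then `iwasawa (g * x) = iwasawa (g * κ) + iwasawa x`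
(`exists_iwasawa_mul`). When the law of `g` is invariant under right multiplication by unitary
matrices, `κ` can be dropped in distribution, so for independent factors the laws of the projections
convolve (`IsRightInvariant.map_iwasawa_mul`). Hence `iwasawa S_k` has the law of a sum of `k`
independent copies of `iwasawa X_1`.

The parameter `-iρ - iλ` makes the spherical function the Laplace transform of `u ↦ iwasawa (e^t u)`
under Haar measure (`spherical_eq`). Therefore `m_1` and `m_2` are its first and second moments,
`m_1(ν)` is the mean of `iwasawa X_1` and `Σ²(ν)` its covariance matrix (`dispersion_apply`,
`modCov_apply`). This gives positive semidefiniteness, and the classical central limit theorem for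
`iwasawa S_k` follows through characteristic functions.

It remains to compare `logSing` with `iwasawa`. Their partial sums differ by a nonnegative defect,
and the defect of `g u` with `u` Haar distributed is bounded by a function of a Haar unitary matrix
alone, finite where its leading minor is nonzero, that is almost everywhere (`le_logMinor_conj`,
`haarU_realDet_leading_eq_zero`). The defect of `S_k` is thus bounded in probability uniformly in
`k`, so it vanishes after division by `√k`, and Slutsky's lemma concludes. -/

theorem star_algebraMap_real (r : ℝ) : star (algebraMap ℝ F r) = algebraMap ℝ F r := by
  rcases hF.out with h | h | h <;> obtain ⟨e⟩ := h <;> apply EquivLike.injective e <;>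
    rw [map_star, AlgHomClass.commutes e]
  · simp
  · simp
  · exact Quaternion.star_coe _

/-- The isomorphism with `ℝ`, `ℂ` or `ℍ` is not assumed isometric. It only shows that `star x * x`
is a nonnegative real scalar; the C*-identity then determines that scalar. -/
theorem star_mul_self_eq_norm_sq (x : F) : star x * x = algebraMap ℝ F (‖x‖ ^ 2) := by
  have key : ∃ r : ℝ, 0 ≤ r ∧ star x * x = algebraMap ℝ F r := by
    rcases hF.out with h | h | h <;> obtain ⟨e⟩ := h
    · refine ⟨e x ^ 2, sq_nonneg _, EquivLike.injective e ?_⟩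
      rw [map_mul, map_star, AlgHomClass.commutes e]
      simp [sq]
    · refine ⟨Complex.normSq (e x), Complex.normSq_nonneg _, EquivLike.injective e ?_⟩
      rw [map_mul, map_star, AlgHomClass.commutes e]
      simpa using (Complex.normSq_eq_conj_mul_self (z := e x)).symm
    · refine ⟨Quaternion.normSq (e x), Quaternion.normSq_nonneg, EquivLike.injective e ?_⟩
      rw [map_mul, map_star, AlgHomClass.commutes e]
      exact Quaternion.star_mul_self _
  obtain ⟨r, hr, h⟩ := key
  have h1 : ‖star x * x‖ = r := by rw [h, norm_algebraMap', Real.norm_of_nonneg hr]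
  rw [CStarRing.norm_star_mul_self] at h1
  rw [h, ← h1, sq]

theorem self_mul_star_eq_norm_sq (x : F) : x * star x = algebraMap ℝ F (‖x‖ ^ 2) := by
  simpa using star_mul_self_eq_norm_sq (star x)

/-- The real part `(x + x*) / 2`, written by polarization. -/
def rePart (x : F) : ℝ := (‖1 + x‖ ^ 2 - ‖1 - x‖ ^ 2) / 4

theorem algebraMap_real_injective : Function.Injective (algebraMap ℝ F) :=
  FaithfulSMul.algebraMap_injective ℝ F

theorem add_star_eq_rePart (x : F) : x + star x = algebraMap ℝ F (2 * rePart x) := by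
  have h : (2 : F) * (x + star x) = (2 : F) * algebraMap ℝ F (2 * rePart x) := by
    calc (2 : F) * (x + star x) = star (1 + x) * (1 + x) - star (1 - x) * (1 - x) := by
          simp only [star_add, star_sub, star_one]; noncomm_ring
      _ = algebraMap ℝ F (‖1 + x‖ ^ 2 - ‖1 - x‖ ^ 2) := by
          rw [star_mul_self_eq_norm_sq, star_mul_self_eq_norm_sq, map_sub]
      _ = (2 : F) * algebraMap ℝ F (2 * rePart x) := by
          rw [← map_ofNat (algebraMap ℝ F) 2, ← map_mul]
          congr 1
          simp only [rePart]; ring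
  exact mul_left_cancel₀ (by rw [← map_ofNat (algebraMap ℝ F) 2]; simp) h

theorem rePart_eq_of_add_star {x : F} {r : ℝ} (h : x + star x = algebraMap ℝ F (2 * r)) :
    rePart x = r := by
  rw [add_star_eq_rePart] at h
  have := algebraMap_real_injective h
  linarith

theorem rePart_add (x y : F) : rePart (x + y) = rePart x + rePart y := by
  apply rePart_eq_of_add_star
  rw [star_add, mul_add, map_add, ← add_star_eq_rePart, ← add_star_eq_rePart]
  abel

theorem rePart_algebraMap (r : ℝ) : rePart (algebraMap ℝ F r) = r := by
  apply rePart_eq_of_add_star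
  rw [star_algebraMap_real, ← map_add, two_mul]

theorem rePart_algebraMap_mul (r : ℝ) (x : F) : rePart (algebraMap ℝ F r * x) = r * rePart x := by
  apply rePart_eq_of_add_star
  rw [star_mul, star_algebraMap_real, ← Algebra.commutes, ← mul_add, add_star_eq_rePart, ← map_mul]
  congr 1; ring

theorem rePart_star (x : F) : rePart (star x) = rePart x := by
  apply rePart_eq_of_add_star
  rw [star_star, add_comm, add_star_eq_rePart]

/-- This trace property replaces commutativity for quaternions. Both `z * star z` and `star z * z`
equal `‖z‖²`; for `z = x + star y` the square terms cancel and the cross terms remain. -/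
theorem rePart_mul_comm (x y : F) : rePart (x * y) = rePart (y * x) := by
  apply rePart_eq_of_add_star
  rw [← add_star_eq_rePart, star_mul, star_mul]
  have h : (x + star y) * star (x + star y) = star (x + star y) * (x + star y) := by
    rw [self_mul_star_eq_norm_sq, star_mul_self_eq_norm_sq]
  simp only [star_add, star_star, add_mul, mul_add] at h
  rw [self_mul_star_eq_norm_sq, star_mul_self_eq_norm_sq, star_mul_self_eq_norm_sq,
    self_mul_star_eq_norm_sq] at h
  have h2 : (algebraMap ℝ F (‖x‖ ^ 2) + algebraMap ℝ F (‖y‖ ^ 2)) + (x * y + star y * star x) =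
    (algebraMap ℝ F (‖x‖ ^ 2) + algebraMap ℝ F (‖y‖ ^ 2)) + (y * x + star x * star y) := by
    convert h using 1 <;> abel
  exact add_left_cancel h2

theorem eq_algebraMap_rePart {x : F} (hx : star x = x) : x = algebraMap ℝ F (rePart x) := by
  have h := add_star_eq_rePart x
  rw [hx, ← two_mul, map_mul, map_ofNat] at h
  exact mul_left_cancel₀ (by rw [← map_ofNat (algebraMap ℝ F) 2]; simp) h

theorem continuous_rePart : Continuous (rePart : F → ℝ) := by
  unfold rePart; fun_prop

end Scalars

/-! ### Reflections and the QR decomposition -/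

section Reflections

variable {F : Type*} [NormedDivisionRing F] [NormedAlgebra ℝ F] [StarRing F] [CStarRing F]
  [hF : Fact (IsRealComplexOrQuaternion F)] {n : Type*} [Fintype n] [DecidableEq n]

theorem star_dotProduct_self (w : n → F) :
    star w ⬝ᵥ w = algebraMap ℝ F (∑ i, ‖w i‖ ^ 2) := by
  simp [dotProduct, map_sum, star_mul_self_eq_norm_sq]

/-- The reflection `1 - 2 w w* / |w|²`. -/
def reflection (w : n → F) : Matrix n n F :=
  1 - Matrix.vecMulVec w (fun i => algebraMap ℝ F (2 / ∑ k, ‖w k‖ ^ 2) * star (w i))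

theorem reflection_apply (w : n → F) (i j : n) : reflection w i j =
    (1 : Matrix n n F) i j - w i * (algebraMap ℝ F (2 / ∑ k, ‖w k‖ ^ 2) * star (w j)) := by
  simp [reflection, vecMulVec]

theorem reflection_mulVec (w x : n → F) : reflection w *ᵥ x =
    fun i => x i - w i * (algebraMap ℝ F (2 / ∑ k, ‖w k‖ ^ 2) * (star w ⬝ᵥ x)) := by
  ext i
  rw [reflection, sub_mulVec, one_mulVec, Pi.sub_apply]
  congr 1
  simp only [mulVec, dotProduct, vecMulVec_apply, Finset.mul_sum, mul_assoc, Pi.star_apply]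

theorem reflection_conjTranspose (w : n → F) : (reflection w)ᴴ = reflection w := by
  ext i j
  rw [conjTranspose_apply, reflection_apply, reflection_apply, star_sub, star_mul, star_mul,
    star_star, star_algebraMap_real, mul_assoc, Algebra.left_comm]
  congr 1
  simp only [one_apply, eq_comm (a := j)]
  split_ifs <;> simp

theorem reflection_mul_self {w : n → F} (hw : w ≠ 0) : reflection w * reflection w = 1 := by
  have hN : (∑ k, ‖w k‖ ^ 2) ≠ 0 := by
    intro h
    apply hw
    ext i
    have := (Finset.sum_eq_zero_iff_of_nonneg (fun i _ => sq_nonneg _)).1 h i (Finset.mem_univ i)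
    simpa using this
  refine Matrix.ext_of_mulVec_single fun k => ?_
  set x : n → F := Pi.single k 1
  rw [← mulVec_mulVec, reflection_mulVec w x, reflection_mulVec, one_mulVec]
  ext i
  have h1 : star w ⬝ᵥ (fun i => x i - w i *
      (algebraMap ℝ F (2 / ∑ k, ‖w k‖ ^ 2) * (star w ⬝ᵥ x))) = - (star w ⬝ᵥ x) := by
    have : (star w ⬝ᵥ (fun i => x i - w i *
      (algebraMap ℝ F (2 / ∑ k, ‖w k‖ ^ 2) * (star w ⬝ᵥ x)))) = star w ⬝ᵥ x - (star w ⬝ᵥ w) *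
      (algebraMap ℝ F (2 / ∑ k, ‖w k‖ ^ 2) * (star w ⬝ᵥ x)) := by
      simp only [dotProduct, mul_sub, Finset.sum_sub_distrib, Finset.sum_mul, mul_assoc]
    rw [this, star_dotProduct_self, ← mul_assoc, ← map_mul, mul_div_cancel₀ _ hN, map_ofNat]
    noncomm_ring
  rw [h1]
  noncomm_ring

theorem reflection_mem_unitary {w : n → F} (hw : w ≠ 0) :
    reflection w ∈ unitary (Matrix n n F) := by
  rw [Unitary.mem_iff, star_eq_conjTranspose, reflection_conjTranspose, reflection_mul_self hw]
  exact ⟨rfl, rfl⟩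

/-- A reflection that maps `y` to a multiple of the `r`-th unit vector. -/
theorem exists_reflection_mulVec_eq_single (y : n → F) (hy : y ≠ 0) (r : n) :
    ∃ w : n → F, w ≠ 0 ∧ (∀ i, i ≠ r → w i = y i) ∧
      ∃ α : F, reflection w *ᵥ y = Pi.single r α := by
  obtain ⟨p, hp, hpr⟩ : ∃ p : F, ‖p‖ = 1 ∧ y r = p * algebraMap ℝ F ‖y r‖ := by
    by_cases h : y r = 0
    · exact ⟨1, by simp, by simp [h]⟩
    · have h' : algebraMap ℝ F ‖y r‖ ≠ 0 := by simpa using h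
      exact ⟨y r * (algebraMap ℝ F ‖y r‖)⁻¹, by
        rw [norm_mul, norm_inv, norm_algebraMap', norm_norm, mul_inv_cancel₀ (by simpa using h)],
        by rw [mul_assoc, inv_mul_cancel₀ h', mul_one]⟩
  set s : ℝ := ∑ i, ‖y i‖ ^ 2 with hs
  have hs0 : 0 < s := by
    obtain ⟨i, hi⟩ := Function.ne_iff.1 hy
    exact Finset.sum_pos' (fun i _ => sq_nonneg _) ⟨i, Finset.mem_univ _, by
      have : 0 < ‖y i‖ := norm_pos_iff.2 (by simpa using hi)
      positivity⟩
  set N := Real.sqrt s with hN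
  have hN0 : 0 < N := Real.sqrt_pos.2 hs0
  have hNs : N * N = s := Real.mul_self_sqrt hs0.le
  -- The phase is opposite to that of `y r`. Then `star w ⬝ᵥ y` is real and equals half of `|w|²`,
  -- so the reflection sends `y` to `y - w`; and `|w|²` is positive even if `y` is already a
  -- multiple of the unit vector.
  set α : F := - (p * algebraMap ℝ F N) with hα
  have hyr : star (y r) = algebraMap ℝ F ‖y r‖ * star p := by
    conv_lhs => rw [hpr]
    rw [star_mul, star_algebraMap_real]
  have hpp : star p * p = 1 := by rw [star_mul_self_eq_norm_sq, hp]; simp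
  have hα' : star α = - (algebraMap ℝ F N * star p) := by
    rw [hα, star_neg, star_mul, star_algebraMap_real]
  set w : n → F := y - Pi.single r α with hw
  have e1 : star w ⬝ᵥ y = algebraMap ℝ F (s + N * ‖y r‖) := by
    have : star α * y r = - algebraMap ℝ F (N * ‖y r‖) := by
      conv_lhs => rw [hpr]
      rw [hα', neg_mul, mul_assoc, ← mul_assoc (star p), hpp, one_mul, map_mul]
    rw [hw, star_sub, sub_dotProduct, star_dotProduct_self, Pi.star_single, single_dotProduct, this,
      sub_neg_eq_add, ← map_add]
  have e2 : (∑ k, ‖w k‖ ^ 2) = 2 * (s + N * ‖y r‖) := by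
    apply algebraMap_real_injective (F := F)
    have h2 : star w r * α = - algebraMap ℝ F (s + N * ‖y r‖) := by
      have : star w r = star (y r) - star α := by simp [hw]
      rw [this, hyr, hα', hα, ← hNs]
      simp only [map_add, map_mul, sub_neg_eq_add, mul_neg, add_mul, neg_inj]
      rw [mul_assoc, ← mul_assoc (star p), hpp, mul_assoc, ← mul_assoc (star p), hpp, one_mul,
        ← map_mul, ← map_mul, ← map_mul, mul_comm, add_comm]
    rw [← star_dotProduct_self]
    conv_lhs => rw [hw, dotProduct_sub, ← hw, e1, dotProduct_single, h2]
    rw [sub_neg_eq_add, ← map_add, two_mul]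
  have hpos : 0 < s + N * ‖y r‖ := by positivity
  refine ⟨w, ?_, fun i hi => by simp [hw, hi], α, ?_⟩
  · rintro h0
    rw [h0] at e2
    simp at e2
    linarith
  · rw [reflection_mulVec, e1, e2, ← map_mul]
    have : 2 / (2 * (s + N * ‖y r‖)) * (s + N * ‖y r‖) = 1 := by field_simp
    rw [this, map_one]
    ext i
    simp [hw]

/-- QR decomposition: every square matrix is upper triangular up to a unitary factor. -/
theorem exists_unitary_mul_upperTriangular {q : ℕ} (x : Matrix (Fin q) (Fin q) F) :
    ∃ u ∈ unitary (Matrix (Fin q) (Fin q) F), ∀ i j, j < i → (u * x) i j = 0 := by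
  have key : ∀ r : ℕ, ∃ u ∈ unitary (Matrix (Fin q) (Fin q) F),
      ∀ i j : Fin q, (j : ℕ) < r → j < i → (u * x) i j = 0 := by
    intro r
    induction r with
    | zero => exact ⟨1, one_mem _, fun i j h => absurd h (Nat.not_lt_zero _)⟩
    | succ r ih =>
      obtain ⟨u, hu, h⟩ := ih
      by_cases hr : r < q
      swap
      · exact ⟨u, hu, fun i j _ hij => h i j (by omega) hij⟩
      set k : Fin q := ⟨r, hr⟩
      set M := u * x with hM
      -- Cutting off the entries above `k` makes `w` vanish there. The reflection then fixes the
      -- first `k` rows, and also the columns already cleared, since these are orthogonal to `w`.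
      set y : Fin q → F := fun i => if i < k then 0 else M i k with hy
      by_cases hy0 : y = 0
      · refine ⟨u, hu, fun i j hj hij => ?_⟩
        rcases (Nat.lt_succ_iff_lt_or_eq.1 hj) with h' | h'
        · exact h i j h' hij
        · have hjk : j = k := Fin.ext h'
          have := congrFun hy0 i
          simp only [hy, Pi.zero_apply] at this
          rw [if_neg (by rw [← hjk]; exact not_lt.2 hij.le)] at this
          rw [hjk]; exact this
      · obtain ⟨w, hw0, hwy, α, hα⟩ := exists_reflection_mulVec_eq_single y hy0 k
        have hwk : ∀ i, i < k → w i = 0 := fun i hi => by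
          rw [hwy i hi.ne]; simp [hy, hi]
        refine ⟨reflection w * u, mul_mem (reflection_mem_unitary hw0) hu, fun i j hj hij => ?_⟩
        have hcol : (reflection w * u * x) i j = (reflection w *ᵥ fun l => M l j) i := by
          rw [mul_assoc, ← hM]; rfl
        rw [hcol]
        rcases (Nat.lt_succ_iff_lt_or_eq.1 hj) with h' | h'
        · have h0 : star w ⬝ᵥ (fun l => M l j) = 0 := by
            refine Finset.sum_eq_zero fun l _ => ?_
            by_cases hl : l < k
            · simp [hwk l hl]
            · have h3 := h l j h' (lt_of_lt_of_le (show j < k from h') (not_lt.1 hl))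
              simp [h3]
          rw [reflection_mulVec, h0]
          simp [h i j h' hij]
        · have hjk : j = k := Fin.ext h'
          rw [hjk] at hij ⊢
          have hsplit : (fun l => M l k) = (fun l => if l < k then M l k else 0) + y := by
            ext l; by_cases hl : l < k <;> simp [hy, hl]
          have h0 : star w ⬝ᵥ (fun l => if l < k then M l k else 0) = 0 := by
            refine Finset.sum_eq_zero fun l _ => ?_
            by_cases hl : l < k
            · simp [hwk l hl]
            · simp [hl]
          rw [hsplit, mulVec_add, hα, reflection_mulVec, h0]
          simp [hij.ne', not_lt.2 hij.le]
  obtain ⟨u, hu, h⟩ := key q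
  exact ⟨u, hu, fun i j => h i j j.2⟩

end Reflections

end BiinvariantWalk

end

noncomputable section

namespace BiinvariantWalk

/-! ### Spectral theorem by maximizing a weighted trace over the unitary group -/

section Spectral

variable {F : Type*} [NormedDivisionRing F] [NormedAlgebra ℝ F] [StarRing F] [CStarRing F]
  [hF : Fact (IsRealComplexOrQuaternion F)] {n : Type*} [Fintype n] [DecidableEq n]

theorem norm_apply_le_one_of_mem_unitary {u : Matrix n n F} (hu : u ∈ unitary (Matrix n n F))
    (i j : n) : ‖u i j‖ ≤ 1 := by
  have h : (star u * u) j j = 1 := by rw [(Unitary.mem_iff.1 hu).1, one_apply_eq]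
  have h1 : (star u * u) j j = algebraMap ℝ F (∑ k, ‖u k j‖ ^ 2) := by
    rw [← star_dotProduct_self]; rfl
  rw [h1, ← map_one (algebraMap ℝ F)] at h
  have h2 := algebraMap_real_injective h
  have h3 : ‖u i j‖ ^ 2 ≤ 1 := by
    rw [← h2]
    exact Finset.single_le_sum (f := fun k => ‖u k j‖ ^ 2) (fun k _ => sq_nonneg _)
      (Finset.mem_univ i)
  nlinarith [norm_nonneg (u i j)]

theorem isCompact_unitary_matrix [FiniteDimensional ℝ F] :
    IsCompact (unitary (Matrix n n F) : Set (Matrix n n F)) := by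
  have : ProperSpace F := FiniteDimensional.proper_real F
  have hK : IsCompact (Set.univ.pi fun _ : n => Set.univ.pi fun _ : n =>
      Metric.closedBall (0 : F) 1) :=
    isCompact_univ_pi fun _ => isCompact_univ_pi fun _ => isCompact_closedBall 0 1
  refine IsCompact.of_isClosed_subset (X := Matrix n n F) hK isClosed_unitary fun u hu i _ j _ => ?_
  simpa using norm_apply_le_one_of_mem_unitary hu i j

/-- The reflection in the plane of two unit vectors that mixes them in the ratio given by `τ` and
the unit scalar `z`. -/
theorem exists_unitary_plane {i j : n} (hij : i ≠ j) (τ : ℝ) {z : F} (hz : ‖z‖ = 1) :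
    ∃ v ∈ unitary (Matrix n n F),
      (∀ k, k ≠ i → k ≠ j → v *ᵥ Pi.single k 1 = Pi.single k 1) ∧
      v *ᵥ Pi.single i 1 = Pi.single i (algebraMap ℝ F ((1 - τ ^ 2) / (1 + τ ^ 2))) +
        Pi.single j (algebraMap ℝ F (2 * τ / (1 + τ ^ 2)) * z) ∧
      v *ᵥ Pi.single j 1 = Pi.single i (algebraMap ℝ F (2 * τ / (1 + τ ^ 2)) * star z) +
        Pi.single j (algebraMap ℝ F (-((1 - τ ^ 2) / (1 + τ ^ 2)))) := by
  set w : n → F := Pi.single i (algebraMap ℝ F τ) - Pi.single j z with hw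
  have hwi : w i = algebraMap ℝ F τ := by simp [hw, hij]
  have hwj : w j = -z := by simp [hw, hij.symm]
  have hwk : ∀ k, k ≠ i → k ≠ j → w k = 0 := fun k h1 h2 => by simp [hw, h1, h2]
  have hpos : 0 < 1 + τ ^ 2 := by positivity
  have hN : ∑ k, ‖w k‖ ^ 2 = 1 + τ ^ 2 := by
    rw [Finset.sum_eq_add i j hij (fun k _ h => by simp [hwk k h.1 h.2]) (by simp) (by simp),
      hwi, hwj, norm_neg, hz, norm_algebraMap', Real.norm_eq_abs, sq_abs]
    ring
  have hw0 : w ≠ 0 := by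
    intro h
    rw [h] at hwj
    have : z = 0 := by simpa using hwj.symm
    rw [this] at hz
    simp at hz
  have hzz : z * star z = 1 := by rw [self_mul_star_eq_norm_sq, hz]; simp
  refine ⟨reflection w, reflection_mem_unitary hw0, ?_, ?_, ?_⟩
  · intro k hki hkj
    rw [reflection_mulVec]
    ext l
    simp [hwk k hki hkj]
  · rw [reflection_mulVec, hN]
    ext l
    rw [dotProduct_single, mul_one, Pi.star_apply, hwi, star_algebraMap_real, ← map_mul]
    by_cases hli : l = i
    · subst hli
      rw [hwi, ← map_mul]
      simp only [Pi.single_eq_same, Pi.add_apply, Pi.single_eq_of_ne hij, add_zero]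
      rw [← map_one (algebraMap ℝ F), ← map_sub]
      congr 1
      field_simp
      ring
    · by_cases hlj : l = j
      · subst hlj
        rw [hwj]
        simp only [Pi.single_eq_of_ne hli, Pi.add_apply, Pi.single_eq_same, zero_add, zero_sub,
          neg_mul, neg_neg]
        rw [← Algebra.commutes]
        congr 2
        ring
      · rw [hwk l hli hlj]
        simp [hli, hlj]
  · rw [reflection_mulVec, hN]
    ext l
    rw [dotProduct_single, mul_one, Pi.star_apply, hwj, star_neg]
    by_cases hli : l = i
    · subst hli
      rw [hwi, ← mul_assoc, ← map_mul]
      simp only [Pi.single_eq_same, Pi.add_apply, Pi.single_eq_of_ne hij, add_zero]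
      rw [zero_sub, mul_neg, neg_neg]
      congr 2
      ring
    · by_cases hlj : l = j
      · subst hlj
        rw [hwj]
        simp only [Pi.single_eq_of_ne hli, Pi.add_apply, Pi.single_eq_same, zero_add]
        rw [mul_neg, neg_mul_neg, Algebra.left_comm, hzz, mul_one, ← map_one (algebraMap ℝ F),
          ← map_sub]
        congr 1
        field_simp
        ring
      · rw [hwk l hli hlj]
        simp [hli, hlj]

theorem conj_apply_self (B v : Matrix n n F) (k : n) :
    (star v * B * v) k k = star (v *ᵥ Pi.single k 1) ⬝ᵥ (B *ᵥ (v *ᵥ Pi.single k 1)) := by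
  rw [mul_assoc, mul_apply]
  refine Finset.sum_congr rfl fun l _ => ?_
  congr 1
  · simp
  · rw [mulVec_mulVec]; simp

theorem rePart_quadratic_plane {B : Matrix n n F} (hB : star B = B) (i j : n)
    (x y : F) :
    rePart (star (Pi.single i x + Pi.single j y : n → F) ⬝ᵥ
      (B *ᵥ (Pi.single i x + Pi.single j y))) =
      ‖x‖ ^ 2 * rePart (B i i) + ‖y‖ ^ 2 * rePart (B j j) + 2 * rePart (star x * B i j * y) := by
  have hBs : ∀ k l, star (B k l) = B l k := fun k l => by
    conv_rhs => rw [← hB]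
    rfl
  have hd : ∀ (k : n) (a : F), rePart (star a * (B k k * a)) = ‖a‖ ^ 2 * rePart (B k k) := by
    intro k a
    rw [rePart_mul_comm, mul_assoc, self_mul_star_eq_norm_sq, ← Algebra.commutes,
      rePart_algebraMap_mul]
  have h1 : rePart (star y * (B j i * x)) = rePart (star x * B i j * y) := by
    rw [← rePart_star, star_mul, star_mul, star_star, hBs, mul_assoc]
  rw [mulVec_add, star_add, add_dotProduct, dotProduct_add, dotProduct_add, Pi.star_single,
    Pi.star_single]
  simp only [single_dotProduct, mulVec_single]
  simp only [MulOpposite.smul_eq_mul_unop, Pi.smul_apply, MulOpposite.unop_op, rePart_add,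
    col_apply]
  rw [hd, hd, h1, mul_assoc]
  ring

/-- Comparing the maximum with its conjugates by plane reflections gives the inequality `key` for
all `τ > 0` and all unit scalars `z`. With the phase of `z` opposite to that of `B i j`, a small `τ`
forces `B i j = 0`; and `τ = 1` orders the diagonal entries. -/
theorem spectral_theorem_aux [FiniteDimensional ℝ F] {B : Matrix n n F} (hB : star B = B)
    {wt : n → ℝ}
    (hmax : ∀ v ∈ unitary (Matrix n n F), ∑ k, wt k * rePart ((star v * B * v) k k) ≤
      ∑ k, wt k * rePart (B k k)) {i j : n} (hw : wt j < wt i) :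
    B i j = 0 ∧ rePart (B j j) ≤ rePart (B i i) := by
  have hij : i ≠ j := fun h => by rw [h] at hw; exact lt_irrefl _ hw
  have key : ∀ (τ : ℝ) (z : F), 0 < τ → ‖z‖ = 1 →
      τ * (rePart (B j j) - rePart (B i i)) + (1 - τ ^ 2) * rePart (B i j * z) ≤ 0 := by
    intro τ z hτ hz
    obtain ⟨v, hv, hk, hi, hj⟩ := exists_unitary_plane hij τ hz
    have hpos : 0 < 1 + τ ^ 2 := by positivity
    have hm := hmax v hv
    have hi' : rePart ((star v * B * v) i i) = ((1 - τ ^ 2) / (1 + τ ^ 2)) ^ 2 * rePart (B i i) +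
        (2 * τ / (1 + τ ^ 2)) ^ 2 * rePart (B j j) +
        2 * ((1 - τ ^ 2) / (1 + τ ^ 2) * (2 * τ / (1 + τ ^ 2)) * rePart (B i j * z)) := by
      rw [conj_apply_self, hi, rePart_quadratic_plane hB i j, norm_mul, norm_algebraMap',
        norm_algebraMap', hz, mul_one, Real.norm_eq_abs, Real.norm_eq_abs, sq_abs, sq_abs,
        star_algebraMap_real, mul_assoc, rePart_algebraMap_mul, Algebra.left_comm,
        rePart_algebraMap_mul, mul_assoc]
    have hj' : rePart ((star v * B * v) j j) = (2 * τ / (1 + τ ^ 2)) ^ 2 * rePart (B i i) +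
        ((1 - τ ^ 2) / (1 + τ ^ 2)) ^ 2 * rePart (B j j) -
        2 * ((1 - τ ^ 2) / (1 + τ ^ 2) * (2 * τ / (1 + τ ^ 2)) * rePart (B i j * z)) := by
      rw [conj_apply_self, hj, rePart_quadratic_plane hB i j, norm_mul, norm_algebraMap',
        norm_algebraMap', norm_star, hz, mul_one, Real.norm_eq_abs, Real.norm_eq_abs, sq_abs,
        sq_abs, star_mul, star_star, star_algebraMap_real, ← Algebra.commutes,
        rePart_algebraMap_mul, ← Algebra.commutes, mul_assoc, rePart_algebraMap_mul, rePart_mul_comm]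
      ring
    have hrest : ∀ k, k ≠ i → k ≠ j → (star v * B * v) k k = B k k := by
      intro k h1 h2
      rw [conj_apply_self, hk k h1 h2]
      simp [Pi.star_single, single_dotProduct]
    have hdiff : ∑ k, wt k * (rePart ((star v * B * v) k k) - rePart (B k k)) ≤ 0 := by
      simp only [mul_sub, Finset.sum_sub_distrib]
      linarith
    rw [Finset.sum_eq_add i j hij (fun k _ h => by rw [hrest k h.1 h.2]; simp) (by simp)
      (by simp), hi', hj'] at hdiff
    have e : wt i * (((1 - τ ^ 2) / (1 + τ ^ 2)) ^ 2 * rePart (B i i) +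
        (2 * τ / (1 + τ ^ 2)) ^ 2 * rePart (B j j) +
        2 * ((1 - τ ^ 2) / (1 + τ ^ 2) * (2 * τ / (1 + τ ^ 2)) * rePart (B i j * z))
        - rePart (B i i)) + wt j * ((2 * τ / (1 + τ ^ 2)) ^ 2 * rePart (B i i) +
        ((1 - τ ^ 2) / (1 + τ ^ 2)) ^ 2 * rePart (B j j) -
        2 * ((1 - τ ^ 2) / (1 + τ ^ 2) * (2 * τ / (1 + τ ^ 2)) * rePart (B i j * z)) -
        rePart (B j j)) = ((wt i - wt j) * (4 * τ / (1 + τ ^ 2) ^ 2)) *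
        (τ * (rePart (B j j) - rePart (B i i)) + (1 - τ ^ 2) * rePart (B i j * z)) := by
      field_simp
      ring
    rw [e] at hdiff
    have hc : 0 < (wt i - wt j) * (4 * τ / (1 + τ ^ 2) ^ 2) :=
      mul_pos (sub_pos.2 hw) (by positivity)
    by_contra hcon
    exact absurd hdiff (not_le.2 (mul_pos hc (not_le.1 hcon)))
  constructor
  · by_contra h0
    set m := ‖B i j‖ with hm
    have hm0 : 0 < m := norm_pos_iff.2 h0
    set D := rePart (B j j) - rePart (B i i)
    have hz : ‖algebraMap ℝ F m⁻¹ * star (B i j)‖ = 1 := by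
      rw [norm_mul, norm_algebraMap', norm_star, norm_inv, ← hm, norm_norm, inv_mul_cancel₀ hm0.ne']
    have hre : rePart (B i j * (algebraMap ℝ F m⁻¹ * star (B i j))) = m := by
      rw [Algebra.left_comm, self_mul_star_eq_norm_sq, ← map_mul, rePart_algebraMap, ← hm]
      field_simp
    have hD : 0 < |D| + m := by positivity
    -- Here `τ (|D| + m) = m / 2`, so the left side of `key` is at least `m / 2 + τ m - τ² m`, which
    -- is positive because `τ ≤ 1 / 2`.
    have h1 := key (m / (2 * (|D| + m))) _ (by positivity) hz
    rw [hre] at h1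
    set τ := m / (2 * (|D| + m)) with hτ
    have hτ0 : 0 < τ := by positivity
    have e1 : τ * (|D| + m) = m / 2 := by rw [hτ]; field_simp
    have e2 : -(τ * |D|) ≤ τ * D := by nlinarith [neg_abs_le D]
    have e3 : τ ≤ 1 / 2 := by
      by_contra hcon
      push Not at hcon
      nlinarith [abs_nonneg D]
    have e4 : τ * m ≤ m / 2 := by nlinarith
    nlinarith [mul_pos hτ0 hm0, mul_pos hτ0 (mul_pos hτ0 hm0), mul_le_mul_of_nonneg_left e4 hτ0.le]
  · have := key 1 1 one_pos (by simp)
    linarith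

/-- Spectral theorem for Hermitian matrices over `F`: the eigenvalues can be ordered along any
injective weight. -/
theorem exists_unitary_conj_eq_diagonal [FiniteDimensional ℝ F] {A : Matrix n n F}
    (hA : star A = A) {wt : n → ℝ} (hwt : Function.Injective wt) :
    ∃ u ∈ unitary (Matrix n n F), ∃ d : n → ℝ,
      star u * A * u = diagonal (fun i => algebraMap ℝ F (d i)) ∧
      ∀ i j, wt j ≤ wt i → d j ≤ d i := by
  have hcont : Continuous fun u : Matrix n n F =>
      ∑ k, wt k * rePart ((star u * A * u) k k) := by
    refine continuous_finsetSum _ fun k _ => continuous_const.mul (continuous_rePart.comp ?_)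
    have : Continuous fun u : Matrix n n F => star u * A * u := by fun_prop
    exact this.matrix_elem k k
  -- The maximum exists by compactness. As the weights are distinct, every off-diagonal entry or its
  -- adjoint is covered by `spectral_theorem_aux`.
  obtain ⟨u, hu, hmax⟩ := isCompact_unitary_matrix.exists_isMaxOn ⟨1, one_mem _⟩
    hcont.continuousOn
  set B := star u * A * u with hB
  have hBs : star B = B := by simp [hB, hA, mul_assoc]
  have hmax' : ∀ v ∈ unitary (Matrix n n F), ∑ k, wt k * rePart ((star v * B * v) k k) ≤
      ∑ k, wt k * rePart (B k k) := by
    intro v hv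
    have h : star v * B * v = star (u * v) * A * (u * v) := by
      simp [hB, mul_assoc]
    rw [h]
    exact hmax (mul_mem hu hv)
  have hBs' : ∀ k l, star (B k l) = B l k := fun k l => by
    conv_rhs => rw [← hBs]
    rfl
  refine ⟨u, hu, fun i => rePart (B i i), ?_, ?_⟩
  · ext i j
    by_cases hij : i = j
    · subst hij
      rw [diagonal_apply_eq]
      exact eq_algebraMap_rePart (hBs' i i)
    · rw [diagonal_apply_ne _ hij]
      rcases lt_or_gt_of_ne (hwt.ne hij) with h | h
      · have := (spectral_theorem_aux hBs hmax' h).1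
        exact (hBs' j i).symm.trans (by rw [this, star_zero])
      · exact (spectral_theorem_aux hBs hmax' h).1
  · intro i j h
    rcases h.eq_or_lt with h | h
    · rw [hwt h]
    · exact (spectral_theorem_aux hBs hmax' h).2

end Spectral

end BiinvariantWalk

end

noncomputable section

namespace BiinvariantWalk

/-! ### Determinants over `F` through the underlying real operators -/

section RealDet

variable {F : Type*} [NormedDivisionRing F] [NormedAlgebra ℝ F] [StarRing F] [CStarRing F]
  {n : Type*} [Fintype n] [DecidableEq n]

/-- The determinant of `A` as a real operator; the `d`-th power of `hermDet A`. -/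
abbrev realDet (A : Matrix n n F) : ℝ := LinearMap.det (realLin A)

theorem realLin_mul (A B : Matrix n n F) : realLin (A * B) = realLin A * realLin B := by
  refine LinearMap.ext fun v => ?_; exact (mulVec_mulVec v A B).symm

theorem realLin_one : realLin (1 : Matrix n n F) = 1 := by
  refine LinearMap.ext fun v => ?_; exact one_mulVec v

theorem realLin_add (A B : Matrix n n F) : realLin (A + B) = realLin A + realLin B := by
  refine LinearMap.ext fun v => ?_; exact add_mulVec A B v

theorem realLin_smul (c : ℝ) (A : Matrix n n F) : realLin (c • A) = c • realLin A := by
  refine LinearMap.ext fun v => ?_; exact smul_mulVec c A v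

theorem realDet_mul (A B : Matrix n n F) : realDet (A * B) = realDet A * realDet B := by
  rw [realDet, realLin_mul, map_mul]

theorem realDet_one : realDet (1 : Matrix n n F) = 1 := by
  rw [realDet, realLin_one, map_one]

variable [FiniteDimensional ℝ F]

theorem realDet_diagonal (d : n → ℝ) :
    realDet (diagonal fun i => algebraMap ℝ F (d i)) = ∏ i, d i ^ Module.finrank ℝ F := by
  have h : realLin (diagonal fun i => algebraMap ℝ F (d i)) =
      LinearMap.pi fun i => (d i • (LinearMap.id : F →ₗ[ℝ] F)).comp (LinearMap.proj i) := by
    refine LinearMap.ext fun v => funext fun i => ?_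
    simp [realLin, mulVec_diagonal, Algebra.smul_def]
  rw [realDet, h, LinearMap.det_pi]
  simp

/-- In a real basis this is Sylvester's identity for real matrices, so noncommutativity of `F` does
no harm. The case `c = 0` is multiplicativity. -/
theorem realDet_smul_one_add_mul_comm {c : ℝ} (A B : Matrix n n F) :
    realDet (c • 1 + A * B) = realDet (c • 1 + B * A) := by
  set b := Module.finBasis ℝ (n → F)
  have h : ∀ A B : Matrix n n F, LinearMap.toMatrix b b (realLin (c • 1 + A * B)) =
      c • 1 + LinearMap.toMatrix b b (realLin A) * LinearMap.toMatrix b b (realLin B) := by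
    intro A B
    rw [realLin_add, realLin_smul, realLin_one, realLin_mul, map_add, map_smul,
      LinearMap.toMatrix_one, LinearMap.toMatrix_mul]
  rw [realDet, realDet, ← LinearMap.det_toMatrix b, ← LinearMap.det_toMatrix b, h, h]
  by_cases hc : c = 0
  · simp [hc, det_mul, mul_comm]
  · have e : ∀ X Y : Matrix (Fin (Module.finrank ℝ (n → F))) (Fin (Module.finrank ℝ (n → F))) ℝ,
        c • 1 + X * Y = c • (1 + (c⁻¹ • X) * Y) := by
      intro X Y
      rw [smul_add, smul_mul_assoc, smul_smul, mul_inv_cancel₀ hc, one_smul]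
    rw [e, e, det_smul, det_smul, det_one_add_mul_comm]
    simp

variable [hF : Fact (IsRealComplexOrQuaternion F)]

/-- A kernel vector of `Aᴴ` is orthogonal to the range of `A`, which is everything, hence to itself.
-/
theorem realDet_conjTranspose_ne_zero {A : Matrix n n F} (h : realDet A ≠ 0) :
    realDet Aᴴ ≠ 0 := by
  intro h0
  obtain ⟨x, hx, hx0⟩ := (Submodule.ne_bot_iff _).1
    (LinearMap.bot_lt_ker_of_det_eq_zero h0).ne'
  have hx' : Aᴴ *ᵥ x = 0 := hx
  have hsurj : Function.Surjective (realLin A) :=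
    ((LinearMap.isUnit_iff_isUnit_det _).2 (isUnit_iff_ne_zero.2 h)
      |> (Module.End.isUnit_iff _).1).2
  obtain ⟨y, hy⟩ := hsurj x
  have hy' : A *ᵥ y = x := hy
  apply hx0
  have h2 : star x ⬝ᵥ x = 0 := by
    conv_lhs => rw [← hy', star_mulVec, ← dotProduct_mulVec, hy', hx', dotProduct_zero]
  rw [star_dotProduct_self, ← map_zero (algebraMap ℝ F)] at h2
  have h3 := algebraMap_real_injective h2
  ext i
  have := (Finset.sum_eq_zero_iff_of_nonneg (fun i _ => sq_nonneg _)).1 h3 i (Finset.mem_univ i)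
  simpa using this

end RealDet

/-! ### Positive semidefinite matrices and monotonicity of the determinant -/

section Psd

variable {F : Type*} [NormedDivisionRing F] [NormedAlgebra ℝ F] [StarRing F] [CStarRing F]
  [hF : Fact (IsRealComplexOrQuaternion F)] {n m : Type*} [Fintype n] [DecidableEq n]
  [Fintype m] [DecidableEq m]

/-- Positive semidefinite Hermitian matrices over `F`. -/
def Psd (P : Matrix n n F) : Prop :=
  Pᴴ = P ∧ ∀ x, 0 ≤ rePart (star x ⬝ᵥ (P *ᵥ x))

theorem Psd.add {P Q : Matrix n n F} (hP : Psd P) (hQ : Psd Q) : Psd (P + Q) := by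
  refine ⟨by rw [conjTranspose_add, hP.1, hQ.1], fun x => ?_⟩
  rw [add_mulVec, dotProduct_add, rePart_add]
  exact add_nonneg (hP.2 x) (hQ.2 x)

theorem Psd.conj {P : Matrix m m F} (hP : Psd P) (B : Matrix m n F) : Psd (Bᴴ * P * B) := by
  refine ⟨by rw [conjTranspose_mul, conjTranspose_mul, conjTranspose_conjTranspose, hP.1,
    Matrix.mul_assoc], fun x => ?_⟩
  have := hP.2 (B *ᵥ x)
  rwa [star_mulVec, ← dotProduct_mulVec, mulVec_mulVec, mulVec_mulVec] at this

theorem psd_diagonal {d : n → ℝ} (hd : ∀ i, 0 ≤ d i) :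
    Psd (diagonal fun i => algebraMap ℝ F (d i)) := by
  refine ⟨?_, fun x => ?_⟩
  · rw [diagonal_conjTranspose]
    congr 1
    ext i
    exact star_algebraMap_real _
  · have : star x ⬝ᵥ ((diagonal fun i => algebraMap ℝ F (d i)) *ᵥ x) =
        algebraMap ℝ F (∑ i, d i * ‖x i‖ ^ 2) := by
      simp only [dotProduct, mulVec_diagonal, Pi.star_apply]
      rw [map_sum]
      refine Finset.sum_congr rfl fun i _ => ?_
      rw [Algebra.left_comm, star_mul_self_eq_norm_sq, map_mul]
    rw [this, rePart_algebraMap]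
    exact Finset.sum_nonneg fun i _ => mul_nonneg (hd i) (sq_nonneg _)

theorem smul_one_eq_diagonal (c : ℝ) :
    (c • 1 : Matrix n n F) = diagonal fun _ => algebraMap ℝ F c := by
  rw [← diagonal_one, ← diagonal_smul]
  congr 1
  ext
  simp [Algebra.algebraMap_eq_smul_one]

theorem psd_smul_one {c : ℝ} (hc : 0 ≤ c) : Psd (c • 1 : Matrix n n F) := by
  rw [smul_one_eq_diagonal]
  exact psd_diagonal fun _ => hc

theorem psd_conjTranspose_mul_self (B : Matrix m n F) : Psd (Bᴴ * B) := by
  have := (psd_smul_one (n := m) (F := F) zero_le_one).conj B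
  simpa using this

variable [FiniteDimensional ℝ F]

theorem Psd.exists_diagonal {P : Matrix n n F} (hP : Psd P) :
    ∃ u ∈ unitary (Matrix n n F), ∃ d : n → ℝ, (∀ i, 0 ≤ d i) ∧
      star u * P * u = diagonal (fun i => algebraMap ℝ F (d i)) := by
  obtain ⟨u, hu, d, h, -⟩ := exists_unitary_conj_eq_diagonal hP.1
    (wt := fun i => ((Fintype.equivFin n i : ℕ) : ℝ))
    (fun i j h => (Fintype.equivFin n).injective (Fin.ext (Nat.cast_injective h)))
  refine ⟨u, hu, d, fun i => ?_, h⟩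
  have h1 := hP.2 (u *ᵥ Pi.single i 1)
  rwa [← conj_apply_self, h, diagonal_apply_eq, rePart_algebraMap] at h1

theorem realDet_unitary_conj {u : Matrix n n F} (hu : u ∈ unitary (Matrix n n F))
    (A : Matrix n n F) : realDet (star u * A * u) = realDet A := by
  have : realDet (star u) * realDet u = 1 := by
    rw [← realDet_mul, (Unitary.mem_iff.1 hu).1, realDet_one]
  rw [realDet_mul, realDet_mul, mul_right_comm, this, one_mul]

theorem Psd.realDet_nonneg {P : Matrix n n F} (hP : Psd P) : 0 ≤ realDet P := by
  obtain ⟨u, hu, d, hd, h⟩ := hP.exists_diagonal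
  rw [← realDet_unitary_conj hu, h, realDet_diagonal]
  exact Finset.prod_nonneg fun i _ => pow_nonneg (hd i) _

theorem Psd.one_le_realDet_one_add {P : Matrix n n F} (hP : Psd P) : 1 ≤ realDet (1 + P) := by
  obtain ⟨u, hu, d, hd, h⟩ := hP.exists_diagonal
  have e : star u * (1 + P) * u = diagonal (fun i => algebraMap ℝ F (1 + d i)) := by
    rw [mul_add, add_mul, h, mul_one, (Unitary.mem_iff.1 hu).1, ← diagonal_one, diagonal_add]
    simp
  rw [← realDet_unitary_conj hu, e, realDet_diagonal]
  calc (1 : ℝ) = ∏ _i : n, 1 := by simp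
    _ ≤ _ := Finset.prod_le_prod (fun _ _ => zero_le_one) fun i _ =>
      one_le_pow₀ (by linarith [hd i])

/-- For invertible `P`, a congruence by `C` turns `P` into the identity and `Q` into another
positive semidefinite matrix, which reduces the claim to `Psd.one_le_realDet_one_add`. The factor
`realDet Cᴴ * realDet C` is positive because its product with `realDet P > 0` is `1`. -/
theorem Psd.realDet_le_add {P Q : Matrix n n F} (hP : Psd P) (hQ : Psd Q) :
    realDet P ≤ realDet (P + Q) := by
  rcases hP.realDet_nonneg.eq_or_lt with h0 | h0
  · rw [← h0]; exact (hP.add hQ).realDet_nonneg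
  obtain ⟨u, hu, d, hd, h⟩ := hP.exists_diagonal
  have hpos : ∀ i, 0 < d i := by
    intro i
    refine (hd i).lt_of_ne fun hi => ?_
    rw [← realDet_unitary_conj hu, h, realDet_diagonal] at h0
    have : Module.finrank ℝ F ≠ 0 := Module.finrank_pos.ne'
    rw [Finset.prod_eq_zero (Finset.mem_univ i) (by rw [← hi, zero_pow this])] at h0
    exact lt_irrefl _ h0
  set E : Matrix n n F := diagonal fun i => algebraMap ℝ F (√(d i))⁻¹ with hE
  set C := u * E with hC
  have hEs : Eᴴ = E := (psd_diagonal (F := F) fun i => inv_nonneg.2 (Real.sqrt_nonneg (d i))).1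
  have h1 : Cᴴ * P * C = 1 := by
    have : Cᴴ * P * C = E * (star u * P * u) * E := by
      rw [hC, conjTranspose_mul, hEs, star_eq_conjTranspose]; simp only [mul_assoc]
    rw [this, h, hE, diagonal_mul_diagonal, diagonal_mul_diagonal, ← diagonal_one]
    congr 1
    ext i
    rw [← map_mul, ← map_mul, ← map_one (algebraMap ℝ F)]
    congr 1
    have := Real.sqrt_pos.2 (hpos i)
    field_simp
    rw [Real.sq_sqrt (hd i)]
  have h2 : 1 ≤ realDet (Cᴴ * (P + Q) * C) := by
    rw [mul_add, add_mul, h1]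
    exact (hQ.conj C).one_le_realDet_one_add
  have h3 : realDet (Cᴴ * P * C) = 1 := by rw [h1, realDet_one]
  rw [realDet_mul, realDet_mul, mul_right_comm] at h2 h3
  have hk : 0 < realDet Cᴴ * realDet C := by
    by_contra hcon
    have := mul_nonpos_of_nonpos_of_nonneg (not_lt.1 hcon) h0.le
    linarith
  exact le_of_mul_le_mul_left (h3.le.trans h2) hk

end Psd

/-! ### Principal minors of `u* D u` -/

section Minors

variable {F : Type*} [NormedDivisionRing F] [NormedAlgebra ℝ F] [StarRing F] [CStarRing F]
  [hF : Fact (IsRealComplexOrQuaternion F)] [FiniteDimensional ℝ F]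
  {n : Type*} [Fintype n] [DecidableEq n] (p : n → Prop) [DecidablePred p]

theorem toBlock_mul_eq_add' (A B : Matrix n n F) : (A * B).toBlock p p =
    A.toBlock p p * B.toBlock p p +
      A.toBlock p (fun i => ¬ p i) * B.toBlock (fun i => ¬ p i) p := by
  ext i j
  simp only [toBlock_apply, mul_apply, Matrix.add_apply]
  exact (Fintype.sum_subtype_add_sum_subtype p fun k => A i k * B k j).symm

theorem toBlock_conj_diagonal (u : Matrix n n F) (d : n → ℝ) :
    (star u * diagonal (fun i => algebraMap ℝ F (d i)) * u).toBlock p p =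
      (u.toBlock p p)ᴴ * diagonal (fun i : {i // p i} => algebraMap ℝ F (d i)) * u.toBlock p p +
      (u.toBlock (fun i => ¬ p i) p)ᴴ *
        diagonal (fun i : {i // ¬ p i} => algebraMap ℝ F (d i)) *
        u.toBlock (fun i => ¬ p i) p := by
  rw [toBlock_mul_eq_add']
  congr 1 <;> congr 1 <;> ext i j <;>
    simp [toBlock_apply, mul_diagonal, star_eq_conjTranspose]

variable {u : Matrix n n F}

theorem toBlock_gram_eq_one (hu : u ∈ unitary (Matrix n n F)) :
    (u.toBlock p p)ᴴ * u.toBlock p p +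
      (u.toBlock (fun i => ¬ p i) p)ᴴ * u.toBlock (fun i => ¬ p i) p = 1 := by
  have h := toBlock_mul_eq_add' p (star u) u
  rw [(Unitary.mem_iff.1 hu).1, toBlock_one_self] at h
  exact h.symm

theorem toBlock_gram'_eq_one (hu : u ∈ unitary (Matrix n n F)) :
    u.toBlock p p * (u.toBlock p p)ᴴ +
      u.toBlock p (fun i => ¬ p i) * (u.toBlock p (fun i => ¬ p i))ᴴ = 1 := by
  have h := toBlock_mul_eq_add' p u (star u)
  rw [(Unitary.mem_iff.1 hu).2, toBlock_one_self] at h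
  exact h.symm

/-- Comparison of a principal minor of `u* D u` with the product of the corresponding entries of
`D` from below. -/
theorem realDet_toBlock_conj_ge {d : n → ℝ} (hd : ∀ i, 0 ≤ d i) :
    (∏ i : {i // p i}, d i ^ Module.finrank ℝ F) * realDet ((u.toBlock p p)ᴴ * u.toBlock p p) ≤
      realDet ((star u * diagonal (fun i => algebraMap ℝ F (d i)) * u).toBlock p p) := by
  rw [toBlock_conj_diagonal]
  refine le_trans (le_of_eq ?_) (((psd_diagonal (F := F) fun i : {i // p i} => hd i).conj
    (u.toBlock p p)).realDet_le_add ((psd_diagonal (F := F) fun i : {i // ¬ p i} => hd i).conj _))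
  rw [realDet_mul, realDet_mul, realDet_mul, realDet_diagonal]
  ring

/-- Comparison of a principal minor of `u* D u` with the product of the largest entries of `D` from
above. -/
theorem realDet_toBlock_conj_le (hu : u ∈ unitary (Matrix n n F))
    {d : n → ℝ} {c : ℝ} (hc : 0 ≤ c) (h1 : ∀ i, p i → c ≤ d i)
    (h2 : ∀ i, ¬ p i → d i ≤ c) (hd : ∀ i, 0 ≤ d i) :
    realDet ((star u * diagonal (fun i => algebraMap ℝ F (d i)) * u).toBlock p p) ≤
      ∏ i : {i // p i}, d i ^ Module.finrank ℝ F := by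
  set W := u.toBlock p p with hW
  set V := u.toBlock (fun i => ¬ p i) p with hV
  set W' := u.toBlock p (fun i => ¬ p i) with hW'
  set G : Matrix {i // p i} {i // p i} F := diagonal fun i => algebraMap ℝ F (√(d i - c)) with hG
  have hGs : Gᴴ = G := (psd_diagonal (F := F) fun i : {i // p i} => Real.sqrt_nonneg (d i - c)).1
  have hGG : c • 1 + G * G = diagonal fun i : {i // p i} => algebraMap ℝ F (d i) := by
    rw [hG, smul_one_eq_diagonal, diagonal_mul_diagonal, diagonal_add]
    congr 1
    ext i
    rw [← map_mul, ← map_add, Real.mul_self_sqrt (sub_nonneg.2 (h1 i i.2))]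
    congr 1; ring
  have hVc : (diagonal fun i : {i // ¬ p i} => algebraMap ℝ F (d i)) +
      (diagonal fun i : {i // ¬ p i} => algebraMap ℝ F (c - d i)) = c • 1 := by
    rw [smul_one_eq_diagonal, diagonal_add]
    congr 1
    ext i
    rw [← map_add]
    congr 1; ring
  -- Raising the entries outside `p` to `c` can only increase the minor, and turns the block into `c
  -- + W* G² W` with `G² = D - c` on `p`. Sylvester's identity exchanges this for `c + G W W* G`,
  -- which is at most `c + G²` because `W W* ≤ 1`.
  have e1 : (star u * diagonal (fun i => algebraMap ℝ F (d i)) * u).toBlock p p +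
      Vᴴ * (diagonal fun i : {i // ¬ p i} => algebraMap ℝ F (c - d i)) * V =
      c • 1 + (Wᴴ * G) * (G * W) := by
    rw [toBlock_conj_diagonal, ← hW, ← hV, add_assoc, ← Matrix.add_mul, ← Matrix.mul_add, hVc,
      ← hGG, Matrix.mul_add, Matrix.add_mul]
    simp only [Matrix.mul_smul, Matrix.smul_mul, Matrix.mul_one, Matrix.mul_assoc]
    rw [← toBlock_gram_eq_one p hu, ← hW, ← hV, smul_add]
    abel
  have hpsd : Psd ((star u * diagonal (fun i => algebraMap ℝ F (d i)) * u).toBlock p p) := by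
    rw [toBlock_conj_diagonal]
    exact ((psd_diagonal (F := F) fun i : {i // p i} => hd i).conj _).add
      ((psd_diagonal (F := F) fun i : {i // ¬ p i} => hd i).conj _)
  have e2 : (c • 1 + (G * W) * (Wᴴ * G)) + (W'ᴴ * G)ᴴ * (W'ᴴ * G) =
      diagonal fun i : {i // p i} => algebraMap ℝ F (d i) := by
    have : (G * W) * (Wᴴ * G) + (W'ᴴ * G)ᴴ * (W'ᴴ * G) = G * (W * Wᴴ + W' * W'ᴴ) * G := by
      rw [conjTranspose_mul, conjTranspose_conjTranspose, hGs]
      simp only [Matrix.mul_add, Matrix.add_mul, Matrix.mul_assoc]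
    rw [add_assoc, this, toBlock_gram'_eq_one p hu, mul_one, hGG]
  have hpsd2 : Psd (c • 1 + (G * W) * (Wᴴ * G)) := by
    refine (psd_smul_one hc).add ?_
    have := psd_conjTranspose_mul_self (Wᴴ * G)
    rwa [conjTranspose_mul, conjTranspose_conjTranspose, hGs] at this
  calc _ ≤ realDet (c • 1 + (Wᴴ * G) * (G * W)) := by
        rw [← e1]
        exact hpsd.realDet_le_add ((psd_diagonal fun i : {i // ¬ p i} =>
          sub_nonneg.2 (h2 i i.2)).conj V)
    _ = realDet (c • 1 + (G * W) * (Wᴴ * G)) := realDet_smul_one_add_mul_comm _ _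
    _ ≤ realDet (diagonal fun i : {i // p i} => algebraMap ℝ F (d i)) := by
        rw [← e2]
        exact hpsd2.realDet_le_add (psd_conjTranspose_mul_self _)
    _ = _ := realDet_diagonal _

/-- This and the next bound come from `c ≤ D` and `D ≤ c`. They hold for every unitary `u` without
any order of the entries, and yield positivity of the minors and linear growth of their logarithms.
-/
theorem realDet_toBlock_conj_ge_pow (hu : u ∈ unitary (Matrix n n F))
    {d : n → ℝ} {c : ℝ} (hc : 0 ≤ c) (hd : ∀ i, c ≤ d i) :
    ∏ _i : {i // p i}, c ^ Module.finrank ℝ F ≤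
      realDet ((star u * diagonal (fun i => algebraMap ℝ F (d i)) * u).toBlock p p) := by
  have e : (star u * diagonal (fun i => algebraMap ℝ F (d i)) * u).toBlock p p =
      c • 1 + (star u * diagonal (fun i => algebraMap ℝ F (d i - c)) * u).toBlock p p := by
    have : diagonal (fun i => algebraMap ℝ F (d i)) =
        (c • 1 : Matrix n n F) + diagonal (fun i => algebraMap ℝ F (d i - c)) := by
      rw [smul_one_eq_diagonal, diagonal_add]
      congr 1
      ext i
      rw [← map_add]
      congr 1; ring
    rw [this, mul_add, add_mul, mul_smul_comm, smul_mul_assoc, mul_one, (Unitary.mem_iff.1 hu).1]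
    ext i j
    simp [toBlock_apply, one_apply, Subtype.ext_iff]
  have hd0 : ∀ i, 0 ≤ d i - c := fun i => sub_nonneg.2 (hd i)
  have hpsd : Psd ((star u * diagonal (fun i => algebraMap ℝ F (d i - c)) * u).toBlock p p) := by
    rw [toBlock_conj_diagonal]
    exact ((psd_diagonal (F := F) fun i : {i // p i} => hd0 i).conj _).add
      ((psd_diagonal (F := F) fun i : {i // ¬ p i} => hd0 i).conj _)
  rw [e, ← realDet_diagonal (F := F), ← smul_one_eq_diagonal]
  exact (psd_smul_one hc).realDet_le_add hpsd

theorem realDet_toBlock_conj_le_pow (hu : u ∈ unitary (Matrix n n F))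
    {d : n → ℝ} {c : ℝ} (hd0 : ∀ i, 0 ≤ d i) (hd : ∀ i, d i ≤ c) :
    realDet ((star u * diagonal (fun i => algebraMap ℝ F (d i)) * u).toBlock p p) ≤
      ∏ _i : {i // p i}, c ^ Module.finrank ℝ F := by
  have hd' : ∀ i, 0 ≤ c - d i := fun i => sub_nonneg.2 (hd i)
  have hpsd : ∀ {d : n → ℝ}, (∀ i, 0 ≤ d i) →
      Psd ((star u * diagonal (fun i => algebraMap ℝ F (d i)) * u).toBlock p p) := by
    intro d hd
    rw [toBlock_conj_diagonal]
    exact ((psd_diagonal (F := F) fun i : {i // p i} => hd i).conj _).add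
      ((psd_diagonal (F := F) fun i : {i // ¬ p i} => hd i).conj _)
  refine ((hpsd hd0).realDet_le_add (hpsd hd')).trans (le_of_eq ?_)
  rw [← realDet_diagonal (F := F), ← smul_one_eq_diagonal]
  congr 2
  have : diagonal (fun i => algebraMap ℝ F (d i)) + diagonal (fun i => algebraMap ℝ F (c - d i)) =
      (c • 1 : Matrix n n F) := by
    rw [smul_one_eq_diagonal, diagonal_add]
    congr 1
    ext i
    rw [← map_add]
    congr 1; ring
  have e : star u * diagonal (fun i => algebraMap ℝ F (d i)) * u +
      star u * diagonal (fun i => algebraMap ℝ F (c - d i)) * u = c • 1 := by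
    rw [← add_mul, ← mul_add, this, mul_smul_comm, smul_mul_assoc, mul_one,
      (Unitary.mem_iff.1 hu).1]
  ext i j
  have := congrFun (congrFun e i) j
  simpa [toBlock_apply, one_apply, Subtype.ext_iff] using this

end Minors

end BiinvariantWalk

end

noncomputable section

namespace BiinvariantWalk

/-! ### Eigenvalues of Gram matrices and the singular spectrum -/

section Eigenvalues

variable {F : Type*} [NormedDivisionRing F] [NormedAlgebra ℝ F] [StarRing F] [CStarRing F]
  [FiniteDimensional ℝ F] [hF : Fact (IsRealComplexOrQuaternion F)] {q : ℕ}

/-- `k.divNat` takes each index `finrank ℝ F` times, the real multiplicity of an eigenvalue over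
`F`. Evaluation at a real `c` reduces the identity to the determinant of a diagonal matrix. -/
theorem charpoly_realLin_conj {u : Matrix (Fin q) (Fin q) F}
    (hu : u ∈ unitary (Matrix (Fin q) (Fin q) F)) (d : Fin q → ℝ) :
    (realLin (star u * diagonal (fun i => algebraMap ℝ F (d i)) * u)).charpoly =
      ∏ k : Fin (q * Module.finrank ℝ F), (Polynomial.X - Polynomial.C (d k.divNat)) := by
  refine Polynomial.funext fun c => ?_
  rw [LinearMap.eval_charpoly, Polynomial.eval_prod]
  have h : algebraMap ℝ _ c - realLin (star u * diagonal (fun i => algebraMap ℝ F (d i)) * u) =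
      realLin (star u * diagonal (fun i => algebraMap ℝ F (c - d i)) * u) := by
    rw [eq_comm, eq_sub_iff_add_eq, ← realLin_add, ← add_mul, ← mul_add, diagonal_add]
    have : (diagonal fun i => algebraMap ℝ F (c - d i) + algebraMap ℝ F (d i)) =
        (c • 1 : Matrix (Fin q) (Fin q) F) := by
      rw [smul_one_eq_diagonal]
      congr 1
      ext i
      rw [← map_add, sub_add_cancel]
    rw [this, mul_smul_comm, mul_one, smul_mul_assoc, (Unitary.mem_iff.1 hu).1, realLin_smul,
      realLin_one]
    rfl
  rw [h]
  refine (realDet_unitary_conj hu _).trans ?_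
  rw [realDet_diagonal, ← finProdFinEquiv.prod_comp, Fintype.prod_prod_type]
  have hdiv : ∀ (i : Fin q) (k : Fin (Module.finrank ℝ F)), (finProdFinEquiv (i, k)).divNat = i :=
    fun i k => congrArg Prod.fst (finProdFinEquiv.symm_apply_apply (i, k))
  simp [hdiv]

/-- The list of the `d i`, each repeated `finrank ℝ F` times, is already decreasing, so it is the
sorted list of roots. Position `finrank ℝ F * j` opens the block of `d j`; the default value is
never reached. -/
theorem eigenvalues_conj_diagonal {u : Matrix (Fin q) (Fin q) F}
    (hu : u ∈ unitary (Matrix (Fin q) (Fin q) F)) {d : Fin q → ℝ} (hd : Antitone d) (j : Fin q) :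
    eigenvalues (star u * diagonal (fun i => algebraMap ℝ F (d i)) * u) j = d j := by
  have hpos : 0 < Module.finrank ℝ F := Module.finrank_pos
  set l : List ℝ := List.ofFn fun k : Fin (q * Module.finrank ℝ F) => d k.divNat with hl
  have hroots : (realLin (star u * diagonal (fun i => algebraMap ℝ F (d i)) * u)).charpoly.roots =
      (l : Multiset ℝ) := by
    rw [charpoly_realLin_conj hu]
    have : ∏ k : Fin (q * Module.finrank ℝ F), (Polynomial.X - Polynomial.C (d k.divNat)) =
        ((l : Multiset ℝ).map fun a => Polynomial.X - Polynomial.C a).prod := by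
      rw [hl, Multiset.map_coe, Multiset.prod_coe, List.map_ofFn, List.prod_ofFn]
      rfl
    rw [this, Polynomial.roots_multiset_prod_X_sub_C]
  have hsort : (realLin (star u * diagonal (fun i => algebraMap ℝ F (d i)) * u)).charpoly.roots.sort
      (· ≥ ·) = l := by
    rw [hroots]
    refine List.Perm.eq_of_pairwise' (r := (· ≥ ·)) (Multiset.pairwise_sort _ _) ?_
      (Multiset.coe_eq_coe.1 (Multiset.sort_eq _ _))
    rw [hl, List.pairwise_ofFn]
    intro a b hab
    exact hd (Fin.le_def.2 (Nat.div_le_div_right hab.le))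
  have hlt : Module.finrank ℝ F * (j : ℕ) < q * Module.finrank ℝ F := by
    rw [mul_comm]; exact Nat.mul_lt_mul_of_pos_right j.2 hpos
  rw [eigenvalues, hsort, hl, List.getD_eq_getElem _ _ (by simpa using hlt), List.getElem_ofFn]
  congr 1
  ext
  simp [Fin.divNat, hpos]

/-- The logarithmic singular spectrum can be read off from any ordered diagonalization of
`g* g`. -/
theorem logSing_eq {g : GL (Fin q) F} {u : Matrix (Fin q) (Fin q) F}
    (hu : u ∈ unitary (Matrix (Fin q) (Fin q) F)) {t : EuclideanSpace ℝ (Fin q)}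
    (ht : Antitone t)
    (h : (g : Matrix (Fin q) (Fin q) F)ᴴ * (g : Matrix (Fin q) (Fin q) F) =
      star u * expDiag F t * u) : logSing g = t := by
  ext j
  have hd : Antitone fun i => Real.exp (2 * t i) := fun i j hij =>
    Real.exp_le_exp.2 (by linarith [ht hij])
  simp only [logSing, singularSpectrum, h, expDiag]
  rw [eigenvalues_conj_diagonal hu hd, Real.log_sqrt (Real.exp_pos _).le, Real.log_exp]
  ring

theorem realDet_coe_ne_zero (g : GL (Fin q) F) :
    realDet (g : Matrix (Fin q) (Fin q) F) ≠ 0 := by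
  intro h
  have := realDet_mul (g : Matrix (Fin q) (Fin q) F) ((g⁻¹ : GL (Fin q) F) : Matrix _ _ F)
  rw [h, zero_mul, Units.mul_inv, realDet_one] at this
  exact one_ne_zero this

/-- The spectral theorem with decreasing weights; the eigenvalues can be written `e^{2t}` because
they are nonnegative and their product is nonzero. -/
theorem exists_gram_eq (g : GL (Fin q) F) : ∃ u : U F q, ∃ t : EuclideanSpace ℝ (Fin q),
    Antitone t ∧ (g : Matrix (Fin q) (Fin q) F)ᴴ * (g : Matrix (Fin q) (Fin q) F) =
      star (u : Matrix (Fin q) (Fin q) F) * expDiag F t * (u : Matrix (Fin q) (Fin q) F) := by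
  set A := (g : Matrix (Fin q) (Fin q) F)ᴴ * (g : Matrix (Fin q) (Fin q) F) with hA
  have hpsd : Psd A := psd_conjTranspose_mul_self _
  obtain ⟨v, hv, d, h, hd⟩ := exists_unitary_conj_eq_diagonal hpsd.1
    (wt := fun i : Fin q => -((i : ℕ) : ℝ))
    (fun i j h => Fin.ext (Nat.cast_injective (neg_injective h)))
  have hd0 : ∀ i, 0 ≤ d i := fun i => by
    have h1 := hpsd.2 (v *ᵥ Pi.single i 1)
    rwa [← conj_apply_self, h, diagonal_apply_eq, rePart_algebraMap] at h1
  have hpos : ∀ i, 0 < d i := by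
    intro i
    refine (hd0 i).lt_of_ne fun hi => ?_
    have h0 : realDet A ≠ 0 := by
      rw [hA, realDet_mul]
      exact mul_ne_zero (realDet_conjTranspose_ne_zero (realDet_coe_ne_zero g))
        (realDet_coe_ne_zero g)
    rw [← realDet_unitary_conj hv, h, realDet_diagonal] at h0
    exact h0 (Finset.prod_eq_zero (Finset.mem_univ i)
      (by rw [← hi, zero_pow Module.finrank_pos.ne']))
  have hvv := (Unitary.mem_iff.1 hv).2
  refine ⟨star ⟨v, hv⟩, WithLp.toLp 2 fun i => Real.log (d i) / 2, ?_, ?_⟩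
  · intro i j hij
    have h1 : d j ≤ d i := hd i j (neg_le_neg (Nat.cast_le.2 hij))
    have h2 := Real.log_le_log (hpos j) h1
    simp only
    linarith
  · have e : expDiag F (WithLp.toLp 2 fun i => Real.log (d i) / 2) =
        diagonal (fun i => algebraMap ℝ F (d i)) := by
      rw [expDiag]
      congr 1
      ext i
      congr 1
      simp only
      rw [mul_div_cancel₀ _ two_ne_zero, Real.exp_log (hpos i)]
    rw [e, ← h]
    change A = star (star v) * (star v * A * v) * star v
    rw [star_star, mul_assoc (star v), ← mul_assoc v, hvv, one_mul, mul_assoc, hvv, mul_one]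

end Eigenvalues

/-! ### Logarithms of leading minors and the Iwasawa cocycle -/

section LogMinors

variable {F : Type*} [NormedDivisionRing F] [NormedAlgebra ℝ F] [StarRing F] [CStarRing F]
  [FiniteDimensional ℝ F] [hF : Fact (IsRealComplexOrQuaternion F)] {q : ℕ}

/-- Half the logarithm of a leading principal minor. -/
def logMinor (x : Matrix (Fin q) (Fin q) F) (r : Fin q) : ℝ := Real.log (minor x r) / 2

/-- The leading block with (0-based) indices at most `r`. -/
abbrev leading (x : Matrix (Fin q) (Fin q) F) (r : Fin q) :
    Matrix {i // i ≤ r} {i // i ≤ r} F := x.toBlock (· ≤ r) (· ≤ r)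

theorem logMinor_eq {x : Matrix (Fin q) (Fin q) F} {r : Fin q} (h : 0 < realDet (leading x r)) :
    logMinor x r = Real.log (realDet (leading x r)) / (2 * Module.finrank ℝ F) := by
  have : minor x r = realDet (leading x r) ^ (1 / (Module.finrank ℝ F : ℝ)) := rfl
  have hd : (0 : ℝ) < Module.finrank ℝ F := Nat.cast_pos.2 Module.finrank_pos
  rw [logMinor, this, Real.log_rpow h]
  field_simp

theorem minor_pos {x : Matrix (Fin q) (Fin q) F} {r : Fin q} (h : 0 < realDet (leading x r)) :
    0 < minor x r := Real.rpow_pos_of_pos h _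

variable {u : Matrix (Fin q) (Fin q) F}

theorem realDet_leading_conj_pos (hu : u ∈ unitary (Matrix (Fin q) (Fin q) F))
    (t : EuclideanSpace ℝ (Fin q)) (r : Fin q) :
    0 < realDet (leading (star u * expDiag F t * u) r) := by
  refine lt_of_lt_of_le ?_ (realDet_toBlock_conj_ge_pow (· ≤ r) hu
    (c := Real.exp (2 * (-∑ i, |t i|))) (Real.exp_pos _).le fun i => ?_)
  · exact Finset.prod_pos fun _ _ => pow_pos (Real.exp_pos _) _
  · have h1 : |t i| ≤ ∑ i, |t i| :=
      Finset.single_le_sum (f := fun i => |t i|) (fun i _ => abs_nonneg _) (Finset.mem_univ i)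
    exact Real.exp_le_exp.2 (by linarith [neg_abs_le (t i)])

theorem log_prod_exp_pow (r : Fin q) (t : Fin q → ℝ) :
    Real.log (∏ i : {i // i ≤ r}, Real.exp (2 * t i) ^ Module.finrank ℝ F) =
      2 * Module.finrank ℝ F * ∑ i ∈ Finset.Iic r, t i := by
  rw [Real.log_prod (fun i _ => (pow_pos (Real.exp_pos _) _).ne')]
  simp only [Real.log_pow, Real.log_exp]
  rw [Finset.mul_sum, Finset.sum_subtype (Finset.Iic r) (p := (· ≤ r)) (by simp)]
  exact Finset.sum_congr rfl fun i _ => by ring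

theorem logMinor_conj_le (hu : u ∈ unitary (Matrix (Fin q) (Fin q) F))
    {t : EuclideanSpace ℝ (Fin q)} (ht : Antitone t) (r : Fin q) :
    logMinor (star u * expDiag F t * u) r ≤ ∑ i ∈ Finset.Iic r, t i := by
  have hd : (0 : ℝ) < 2 * Module.finrank ℝ F := by
    have : (0 : ℝ) < Module.finrank ℝ F := Nat.cast_pos.2 Module.finrank_pos
    positivity
  rw [logMinor_eq (realDet_leading_conj_pos hu t r), div_le_iff₀' hd, ← log_prod_exp_pow]
  refine Real.log_le_log (realDet_leading_conj_pos hu t r) ?_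
  refine realDet_toBlock_conj_le (· ≤ r) hu (c := Real.exp (2 * t r)) (Real.exp_pos _).le
    (fun i hi => ?_) (fun i hi => ?_) (fun i => (Real.exp_pos _).le)
  · exact Real.exp_le_exp.2 (by linarith [ht hi])
  · exact Real.exp_le_exp.2 (by linarith [ht (not_le.1 hi).le])

/-- The error against the upper bound `logMinor_conj_le` depends on `u` but not on `t`. This
uniformity is what makes the defect negligible at scale `√k`. -/
theorem le_logMinor_conj (hu : u ∈ unitary (Matrix (Fin q) (Fin q) F))
    (t : EuclideanSpace ℝ (Fin q)) (r : Fin q) (h : realDet (leading u r) ≠ 0) :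
    ∑ i ∈ Finset.Iic r, t i +
      Real.log (realDet ((leading u r)ᴴ * leading u r)) / (2 * Module.finrank ℝ F) ≤
      logMinor (star u * expDiag F t * u) r := by
  have hd : (0 : ℝ) < 2 * Module.finrank ℝ F := by
    have : (0 : ℝ) < Module.finrank ℝ F := Nat.cast_pos.2 Module.finrank_pos
    positivity
  have h1 : 0 < realDet ((leading u r)ᴴ * leading u r) := by
    refine (psd_conjTranspose_mul_self (leading u r)).realDet_nonneg.lt_of_ne' ?_
    rw [realDet_mul]
    exact mul_ne_zero (realDet_conjTranspose_ne_zero h) h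
  have h2 : 0 < ∏ i : {i // i ≤ r}, Real.exp (2 * t i) ^ Module.finrank ℝ F :=
    Finset.prod_pos fun _ _ => pow_pos (Real.exp_pos _) _
  rw [logMinor_eq (realDet_leading_conj_pos hu t r), le_div_iff₀ hd, add_mul,
    div_mul_cancel₀ _ hd.ne', mul_comm _ (2 * _), ← log_prod_exp_pow, ← Real.log_mul h2.ne' h1.ne']
  exact Real.log_le_log (mul_pos h2 h1)
    (realDet_toBlock_conj_ge (u := u) (· ≤ r) (d := fun i => Real.exp (2 * t i))
      fun i => (Real.exp_pos _).le)

/-- Growth linear in `t` and uniform in `u`: it justifies differentiation under the Haar integral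
and carries the second moments of `ν` over to the Iwasawa projection. -/
theorem abs_logMinor_conj_le (hu : u ∈ unitary (Matrix (Fin q) (Fin q) F))
    (t : EuclideanSpace ℝ (Fin q)) (r : Fin q) :
    |logMinor (star u * expDiag F t * u) r| ≤ q * ∑ i, |t i| := by
  have hd : (0 : ℝ) < 2 * Module.finrank ℝ F := by
    have : (0 : ℝ) < Module.finrank ℝ F := Nat.cast_pos.2 Module.finrank_pos
    positivity
  set c : ℝ := ∑ i, |t i| with hc
  have hc0 : 0 ≤ c := Finset.sum_nonneg fun i _ => abs_nonneg _
  have hci : ∀ i, |t i| ≤ c := fun i =>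
    Finset.single_le_sum (f := fun i => |t i|) (fun i _ => abs_nonneg _) (Finset.mem_univ i)
  have hcard : ((Finset.Iic r).card : ℝ) ≤ q := by
    have := Finset.card_le_univ (Finset.Iic r)
    rw [Fintype.card_fin] at this
    exact_mod_cast this
  have hsum : ∀ a : ℝ, ∑ _i ∈ Finset.Iic r, a = (Finset.Iic r).card * a := fun a => by simp
  rw [logMinor_eq (realDet_leading_conj_pos hu t r), abs_le]
  constructor
  · rw [le_div_iff₀ hd]
    refine le_trans ?_ (Real.log_le_log (Finset.prod_pos fun _ _ => pow_pos (Real.exp_pos _) _)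
      (realDet_toBlock_conj_ge_pow (· ≤ r) hu (c := Real.exp (2 * (-c))) (Real.exp_pos _).le
        fun i => Real.exp_le_exp.2 (by linarith [neg_abs_le (t i), hci i])))
    rw [log_prod_exp_pow r (fun _ => -c), hsum]
    nlinarith [mul_le_mul_of_nonneg_right hcard hc0]
  · rw [div_le_iff₀ hd]
    refine le_trans (Real.log_le_log (realDet_leading_conj_pos hu t r)
      (realDet_toBlock_conj_le_pow (· ≤ r) hu (c := Real.exp (2 * c)) (fun i => (Real.exp_pos _).le)
        fun i => Real.exp_le_exp.2 (by linarith [le_abs_self (t i), hci i]))) ?_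
    rw [log_prod_exp_pow r (fun _ => c), hsum]
    nlinarith [mul_le_mul_of_nonneg_right hcard hc0]

theorem logMinor_expDiag (t : EuclideanSpace ℝ (Fin q)) (ht : Antitone t) (r : Fin q) :
    logMinor (expDiag F t) r = ∑ i ∈ Finset.Iic r, t i := by
  have h1 := logMinor_conj_le (F := F) (one_mem _) ht r
  have e : leading (1 : Matrix (Fin q) (Fin q) F) r = 1 := by
    ext i j; simp [toBlock_apply, one_apply, Subtype.ext_iff]
  have h2 := le_logMinor_conj (F := F) (one_mem _) t r (by rw [e, realDet_one]; exact one_ne_zero)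
  rw [e, conjTranspose_one, one_mul, realDet_one, Real.log_one, zero_div, add_zero] at h2
  rw [star_one, one_mul, mul_one] at h1 h2
  exact le_antisymm h1 h2

theorem realDet_leading_gram_pos (g : GL (Fin q) F) (r : Fin q) :
    0 < realDet (leading ((g : Matrix (Fin q) (Fin q) F)ᴴ * (g : Matrix (Fin q) (Fin q) F)) r) := by
  obtain ⟨u, t, -, h⟩ := exists_gram_eq g
  rw [h]
  exact realDet_leading_conj_pos u.2 t r

/-- The partial sums of the Iwasawa projection: half the logarithms of the minors of `g* g`. -/
def logMinorGram (g : GL (Fin q) F) (r : Fin q) : ℝ :=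
  logMinor ((g : Matrix (Fin q) (Fin q) F)ᴴ * (g : Matrix (Fin q) (Fin q) F)) r

/-- The cocycle identity: up to a unitary factor between `g` and `x`, the partial sums are
additive. -/
theorem exists_logMinorGram_mul (x : GL (Fin q) F) : ∃ κ : U F q, ∀ (g : GL (Fin q) F) (r : Fin q),
    logMinorGram (g * x) r = logMinorGram (g * Unitary.toUnits κ) r + logMinorGram x r := by
  obtain ⟨v, hv, hτ⟩ := exists_unitary_mul_upperTriangular (x : Matrix (Fin q) (Fin q) F)
  set τ := v * (x : Matrix (Fin q) (Fin q) F) with hτx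
  have hvv := (Unitary.mem_iff.1 hv).1
  have hx : (x : Matrix (Fin q) (Fin q) F) = star v * τ := by
    rw [hτx, ← mul_assoc, hvv, one_mul]
  -- With `x = star v * τ`, the unitary factor depends on `x` alone, so that invariance of the law
  -- of `g` can absorb it later.
  refine ⟨star ⟨v, hv⟩, fun g r => ?_⟩
  -- Taking leading blocks is multiplicative here because the lower left block of the triangular `τ`
  -- vanishes.
  have hblock : ∀ Y : Matrix (Fin q) (Fin q) F, leading (τᴴ * (Y * τ)) r =
      (leading τ r)ᴴ * (leading Y r * leading τ r) := by
    intro Y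
    have h0 : τ.toBlock (fun i => ¬ i ≤ r) (· ≤ r) = 0 := by
      ext i j
      exact hτ i j (lt_of_le_of_lt j.2 (not_le.1 i.2))
    have h1 : τᴴ.toBlock (· ≤ r) (fun i => ¬ i ≤ r) = 0 := by
      rw [← conjTranspose_zero, ← h0]; rfl
    rw [leading, toBlock_mul_eq_add', toBlock_mul_eq_add' _ Y τ, h0, h1, Matrix.mul_zero,
      Matrix.zero_mul, add_zero, add_zero]
    rfl
  have hcoe : ((g * Unitary.toUnits (star ⟨v, hv⟩ : U F q) : GL (Fin q) F) :
      Matrix (Fin q) (Fin q) F) = (g : Matrix (Fin q) (Fin q) F) * star v := rfl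
  set Y := (((g * Unitary.toUnits (star ⟨v, hv⟩ : U F q) : GL (Fin q) F) :
      Matrix (Fin q) (Fin q) F))ᴴ * ((g * Unitary.toUnits (star ⟨v, hv⟩ : U F q) : GL (Fin q) F) :
      Matrix (Fin q) (Fin q) F) with hY
  have e1 : ((g * x : GL (Fin q) F) : Matrix (Fin q) (Fin q) F)ᴴ *
      ((g * x : GL (Fin q) F) : Matrix (Fin q) (Fin q) F) = τᴴ * (Y * τ) := by
    rw [hY, hcoe, Units.val_mul, hx]
    simp only [conjTranspose_mul, mul_assoc]
  have e2 : (x : Matrix (Fin q) (Fin q) F)ᴴ * (x : Matrix (Fin q) (Fin q) F) = τᴴ * (1 * τ) := by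
    rw [hx, conjTranspose_mul, one_mul, mul_assoc, ← mul_assoc (star v)ᴴ]
    have hv2 := (Unitary.mem_iff.1 hv).2
    rw [star_eq_conjTranspose] at hv2 ⊢
    rw [conjTranspose_conjTranspose, hv2, one_mul]
  have p1 := realDet_leading_gram_pos (g * x) r
  have p2 := realDet_leading_gram_pos (g * Unitary.toUnits (star ⟨v, hv⟩ : U F q)) r
  have p3 := realDet_leading_gram_pos x r
  have hone : leading (1 : Matrix (Fin q) (Fin q) F) r = 1 := by
    ext i j; simp [toBlock_apply, one_apply, Subtype.ext_iff]
  rw [logMinorGram, logMinorGram, logMinorGram, logMinor_eq p1, logMinor_eq p2, logMinor_eq p3,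
    ← add_div]
  congr 1
  rw [← Real.log_mul p2.ne' p3.ne', e1, e2, hblock, hblock, hone, one_mul, ← hY, realDet_mul,
    realDet_mul, realDet_mul]
  congr 1
  ring

end LogMinors

end BiinvariantWalk

end

noncomputable section

namespace BiinvariantWalk

/-! ### Topology, continuity and Haar measure -/

section Topology

variable {F : Type*} [NormedDivisionRing F] [NormedAlgebra ℝ F] [StarRing F] [CStarRing F]
  [FiniteDimensional ℝ F] {q : ℕ}

instance instSecondCountableTopologyMatrix :
    SecondCountableTopology (Matrix (Fin q) (Fin q) F) := by
  have : ProperSpace F := FiniteDimensional.proper_real F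
  exact inferInstanceAs (SecondCountableTopology (Fin q → Fin q → F))

instance instSecondCountableTopologyGL : SecondCountableTopology (GL (Fin q) F) := by
  have : SecondCountableTopology (Matrix (Fin q) (Fin q) F)ᵐᵒᵖ :=
    MulOpposite.opHomeomorph.symm.isInducing.secondCountableTopology
  exact Units.isEmbedding_embedProduct.isInducing.secondCountableTopology

instance instSecondCountableTopologyU : SecondCountableTopology (U F q) :=
  Topology.IsInducing.secondCountableTopology (f := fun u : U F q =>
    (u : Matrix (Fin q) (Fin q) F)) ⟨rfl⟩

theorem continuous_realDet {n : Type*} [Fintype n] [DecidableEq n] :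
    Continuous (realDet : Matrix n n F → ℝ) := by
  set b := Module.finBasis ℝ (n → F)
  let Φ : (n → n → F) →ₗ[ℝ] (Fin (Module.finrank ℝ (n → F)) → Fin (Module.finrank ℝ (n → F)) → ℝ) :=
    { toFun := fun A => LinearMap.toMatrix b b (realLin (Matrix.of A))
      map_add' := fun A B => by
        rw [← Matrix.of_add_of, realLin_add, map_add]; rfl
      map_smul' := fun c A => by
        rw [← Matrix.smul_of, realLin_smul, map_smul]; rfl }
  have hΦ : Continuous Φ := Φ.continuous_of_finiteDimensional
  have h : (realDet : Matrix n n F → ℝ) = fun A => Matrix.det (Matrix.of (Φ A)) := by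
    ext A
    exact (LinearMap.det_toMatrix b (realLin A)).symm
  rw [h]
  exact Continuous.matrix_det hΦ

variable [hF : Fact (IsRealComplexOrQuaternion F)]

instance instCompactSpaceU : CompactSpace (U F q) :=
  isCompact_iff_compactSpace.1 isCompact_unitary_matrix

instance instIsProbabilityMeasureHaarU : IsProbabilityMeasure (haarU F q) := by
  constructor
  rw [haarU, Measure.smul_apply, smul_eq_mul]
  exact ENNReal.inv_mul_cancel (Measure.measure_univ_ne_zero.2 NeZero.out) (measure_ne_top _ _)

instance instIsMulLeftInvariantHaarU : (haarU F q).IsMulLeftInvariant := by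
  rw [haarU]; infer_instance

theorem continuous_leading (r : Fin q) :
    Continuous fun x : Matrix (Fin q) (Fin q) F => leading x r :=
  continuous_id.matrix_submatrix _ _

theorem continuous_logMinor {α : Type*} [TopologicalSpace α] {f : α → Matrix (Fin q) (Fin q) F}
    (hf : Continuous f) {r : Fin q} (h : ∀ a, 0 < realDet (leading (f a) r)) :
    Continuous fun a => logMinor (f a) r := by
  simp only [fun a => logMinor_eq (h a)]
  exact ((continuous_realDet.comp ((continuous_leading r).comp hf)).log
    fun a => (h a).ne').div_const _

theorem continuous_logMinorGram (r : Fin q) :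
    Continuous fun g : GL (Fin q) F => logMinorGram g r := by
  refine continuous_logMinor ?_ fun g => realDet_leading_gram_pos g r
  have : Continuous fun g : GL (Fin q) F => (g : Matrix (Fin q) (Fin q) F) := Units.continuous_val
  exact this.matrix_conjTranspose.matrix_mul this

theorem continuous_expDiag :
    Continuous fun t : EuclideanSpace ℝ (Fin q) => expDiag F t := by
  refine Continuous.matrix_diagonal (continuous_pi fun i => ?_)
  have : Continuous (algebraMap ℝ F) := continuous_algebraMap ℝ F
  exact this.comp (Real.continuous_exp.comp (continuous_const.mul (by fun_prop)))

theorem continuous_logMinor_conj (r : Fin q) :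
    Continuous fun p : EuclideanSpace ℝ (Fin q) × U F q =>
      logMinor (star (p.2 : Matrix (Fin q) (Fin q) F) * expDiag F p.1 *
        (p.2 : Matrix (Fin q) (Fin q) F)) r := by
  refine continuous_logMinor ?_ fun p => realDet_leading_conj_pos p.2.2 p.1 r
  have h1 : Continuous fun p : EuclideanSpace ℝ (Fin q) × U F q =>
      (p.2 : Matrix (Fin q) (Fin q) F) := continuous_subtype_val.comp continuous_snd
  have h2 := (continuous_expDiag (F := F) (q := q)).comp
    (continuous_fst (Y := U F q))
  exact (h1.star.matrix_mul h2).matrix_mul h1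

theorem continuous_toUnits :
    Continuous fun u : U F q => (Unitary.toUnits u : GL (Fin q) F) := by
  refine Units.continuous_iff.2 ⟨continuous_subtype_val, ?_⟩
  exact continuous_star.comp continuous_subtype_val

end Topology

/-! ### Passing from partial sums to coordinates -/

section Differences

variable {q : ℕ}

/-- The successive differences of a finite sequence, starting from `0`. -/
def diffs (f : Fin q → ℝ) (r : Fin q) : ℝ :=
  f r - if h : 0 < (r : ℕ) then f ⟨(r : ℕ) - 1, by omega⟩ else 0

theorem diffs_sum_Iic (t : Fin q → ℝ) : diffs (fun r => ∑ i ∈ Finset.Iic r, t i) = t := by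
  ext r
  unfold diffs
  split_ifs with h
  · have : Finset.Iic r = insert r (Finset.Iic ⟨(r : ℕ) - 1, by omega⟩) := by
      ext i
      simp only [Finset.mem_Iic, Finset.mem_insert, Fin.le_def, Fin.ext_iff]
      omega
    simp only
    rw [this, Finset.sum_insert (by simp [Fin.le_def]; omega)]
    ring
  · have : Finset.Iic r = {r} := by
      ext i
      simp only [Finset.mem_Iic, Finset.mem_singleton, Fin.le_def, Fin.ext_iff]
      omega
    simp only
    rw [this, Finset.sum_singleton, sub_zero]

theorem diffs_add (f g : Fin q → ℝ) : diffs (f + g) = diffs f + diffs g := by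
  ext r
  simp only [diffs, Pi.add_apply]
  split_ifs <;> ring

theorem diffs_sub (f g : Fin q → ℝ) : diffs (f - g) = diffs f - diffs g := by
  ext r
  simp only [diffs, Pi.sub_apply]
  split_ifs <;> ring

theorem abs_diffs_le {f : Fin q → ℝ} {c : ℝ} (h : ∀ r, |f r| ≤ c) (r : Fin q) :
    |diffs f r| ≤ 2 * c := by
  have hc : 0 ≤ c := (abs_nonneg _).trans (h r)
  unfold diffs
  split_ifs with h0
  · exact (abs_sub _ _).trans (by linarith [h r, h ⟨(r : ℕ) - 1, by omega⟩])
  · rw [sub_zero]; linarith [h r]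

theorem continuous_diffs {α : Type*} [TopologicalSpace α] {f : α → Fin q → ℝ}
    (hf : ∀ r, Continuous fun a => f a r) (r : Fin q) : Continuous fun a => diffs (f a) r := by
  unfold diffs
  split_ifs with h
  · exact (hf _).sub (hf _)
  · exact (hf _).sub continuous_const

theorem measurable_diffs {α : Type*} [MeasurableSpace α] {f : α → Fin q → ℝ}
    (hf : ∀ r, Measurable fun a => f a r) (r : Fin q) : Measurable fun a => diffs (f a) r := by
  unfold diffs
  split_ifs with h
  · exact (hf _).sub (hf _)
  · exact (hf _).sub measurable_const

/-- Summation by parts. -/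
theorem sum_mul_sub_next (f lam : Fin q → ℝ) :
    ∑ r : Fin q, f r * (lam r - if h : (r : ℕ) + 1 < q then lam ⟨(r : ℕ) + 1, h⟩ else 0) =
      ∑ r, lam r * diffs f r := by
  cases q with
  | zero => simp
  | succ n =>
    have h1 : ∑ r : Fin (n + 1), f r *
        (if h : (r : ℕ) + 1 < n + 1 then lam ⟨(r : ℕ) + 1, h⟩ else 0) =
        ∑ r : Fin n, f r.castSucc * lam r.succ := by
      rw [Fin.sum_univ_castSucc]
      simp [Fin.succ]
    have h2 : ∑ r : Fin (n + 1), lam r *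
        (if h : 0 < (r : ℕ) then f ⟨(r : ℕ) - 1, by omega⟩ else 0) =
        ∑ r : Fin n, f r.castSucc * lam r.succ := by
      rw [Fin.sum_univ_succ]
      simp [Fin.castSucc, Fin.castAdd, Fin.castLE, mul_comm]
    simp only [diffs, mul_sub, Finset.sum_sub_distrib]
    rw [h1, h2]
    congr 1
    exact Finset.sum_congr rfl fun r _ => mul_comm _ _

end Differences

/-! ### The Iwasawa projection and a variational formula for the singular spectrum -/

section LogSing

variable {F : Type*} [NormedDivisionRing F] [NormedAlgebra ℝ F] [StarRing F] [CStarRing F]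
  [FiniteDimensional ℝ F] [hF : Fact (IsRealComplexOrQuaternion F)] {q : ℕ}

/-- The Iwasawa projection of `g`: the logarithms of the diagonal part of its QR decomposition. -/
def iwasawa (g : GL (Fin q) F) : EuclideanSpace ℝ (Fin q) := WithLp.toLp 2 (diffs (logMinorGram g))

/-- A unitary matrix that diagonalizes `g* g` in such a way that the minors of every translate of
`g` become those of the diagonal matrix. -/
theorem exists_logMinorGram_mul_toUnits (g : GL (Fin q) F) : Antitone (logSing g) ∧
    ∃ k : U F q, ∀ (u : U F q) (r : Fin q),
      logMinorGram (g * Unitary.toUnits u) r =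
        logMinor (star ((k * u : U F q) : Matrix (Fin q) (Fin q) F) * expDiag F (logSing g) *
          ((k * u : U F q) : Matrix (Fin q) (Fin q) F)) r := by
  obtain ⟨k, t, ht, h⟩ := exists_gram_eq g
  have hlog := logSing_eq k.2 ht h
  refine ⟨hlog ▸ ht, k, fun u r => ?_⟩
  rw [logMinorGram, hlog]
  congr 1
  have e : ((g * Unitary.toUnits u : GL (Fin q) F) : Matrix (Fin q) (Fin q) F) =
      (g : Matrix (Fin q) (Fin q) F) * (u : Matrix (Fin q) (Fin q) F) := rfl
  rw [e, conjTranspose_mul, mul_assoc, ← mul_assoc (g : Matrix (Fin q) (Fin q) F)ᴴ, h,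
    Submonoid.coe_mul, star_mul, star_eq_conjTranspose (u : Matrix (Fin q) (Fin q) F)]
  simp only [mul_assoc]

theorem logMinorGram_le_sum_logSing (g : GL (Fin q) F) (u : U F q) (r : Fin q) :
    logMinorGram (g * Unitary.toUnits u) r ≤ ∑ i ∈ Finset.Iic r, logSing g i := by
  obtain ⟨ht, k, hk⟩ := exists_logMinorGram_mul_toUnits g
  rw [hk]
  exact logMinor_conj_le (k * u).2 ht r

/-- The supremum is attained at the `u` that undoes the diagonalizing matrix `k`. The formula
supplies both the measurability of `logSing` and its invariance under right unitary factors. -/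
theorem sum_logSing_eq_iSup (g : GL (Fin q) F) (r : Fin q) :
    ∑ i ∈ Finset.Iic r, logSing g i = ⨆ u : U F q, logMinorGram (g * Unitary.toUnits u) r := by
  refine le_antisymm ?_ (ciSup_le fun u => logMinorGram_le_sum_logSing g u r)
  obtain ⟨ht, k, hk⟩ := exists_logMinorGram_mul_toUnits g
  refine le_ciSup_of_le ⟨_, by rintro _ ⟨u, rfl⟩; exact logMinorGram_le_sum_logSing g u r⟩ k⁻¹ ?_
  rw [hk, mul_inv_cancel]
  simp [logMinor_expDiag _ ht]

theorem measurable_logSing : Measurable (logSing : GL (Fin q) F → EuclideanSpace ℝ (Fin q)) := by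
  have h : (logSing : GL (Fin q) F → EuclideanSpace ℝ (Fin q)) = fun g => WithLp.toLp 2
      (diffs fun r => ⨆ u : U F q, logMinorGram (g * Unitary.toUnits u) r) := by
    ext g j
    simp only [← sum_logSing_eq_iSup]
    rw [diffs_sum_Iic]
  rw [h]
  refine (WithLp.measurable_toLp 2 _).comp (measurable_pi_lambda _ (measurable_diffs fun r => ?_))
  -- The supremum is uncountable, but a supremum of continuous functions is lower semicontinuous,
  -- hence Borel.
  refine LowerSemicontinuous.measurable (lowerSemicontinuous_ciSup (fun g =>
    ⟨_, by rintro _ ⟨u, rfl⟩; exact logMinorGram_le_sum_logSing g u r⟩) fun u => ?_)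
  exact ((continuous_logMinorGram r).comp (continuous_mul_const _)).lowerSemicontinuous

theorem continuous_iwasawa : Continuous (iwasawa : GL (Fin q) F → EuclideanSpace ℝ (Fin q)) :=
  (PiLp.continuous_toLp 2 _).comp (continuous_pi (continuous_diffs continuous_logMinorGram))

theorem exists_iwasawa_mul (x : GL (Fin q) F) : ∃ κ : U F q, ∀ g : GL (Fin q) F,
    iwasawa (g * x) = iwasawa (g * Unitary.toUnits κ) + iwasawa x := by
  obtain ⟨κ, hκ⟩ := exists_logMinorGram_mul x
  refine ⟨κ, fun g => ?_⟩
  have : logMinorGram (g * x) = logMinorGram (g * Unitary.toUnits κ) + logMinorGram x :=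
    funext (hκ g)
  rw [iwasawa, this, diffs_add]
  rfl

end LogSing

end BiinvariantWalk

end

noncomputable section

namespace BiinvariantWalk

/-! ### Differentiating Laplace transforms -/

section Laplace

variable {Ω : Type*} [MeasurableSpace Ω] {μ : Measure Ω} [IsFiniteMeasure μ] {q : ℕ}

/-- Differentiation of a Laplace transform of a bounded random vector. -/
theorem hasLineDerivAt_integral_exp {h : Ω → ℝ} {a : Ω → Fin q → ℝ} (hh : Measurable h)
    (ha : ∀ j, Measurable fun u => a u j) {B C : ℝ} (hB : ∀ u, |h u| ≤ B)
    (hC : ∀ u j, |a u j| ≤ C) (lam : Fin q → ℝ) (j : Fin q) :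
    HasLineDerivAt ℝ (fun lam : Fin q → ℝ =>
      ((∫ u, h u * Real.exp (∑ l, lam l * a u l) ∂μ : ℝ) : ℂ))
      ((∫ u, (h u * a u j) * Real.exp (∑ l, lam l * a u l) ∂μ : ℝ) : ℂ) lam (Pi.single j 1) := by
  set S : Ω → ℝ := fun u => ∑ l, lam l * a u l with hS
  have hSm : Measurable S := by
    refine Finset.measurable_fun_sum _ fun l _ => (ha l).const_mul _
  set D : ℝ := ∑ l, |lam l| * C with hD
  have hSD : ∀ u, S u ≤ D := fun u => Finset.sum_le_sum fun l _ =>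
    (le_abs_self _).trans (by rw [abs_mul]; exact mul_le_mul_of_nonneg_left (hC u l) (abs_nonneg _))
  have hline : ∀ (s : ℝ) (u : Ω),
      ∑ l, (lam + s • (Pi.single j 1 : Fin q → ℝ)) l * a u l = S u + s * a u j := by
    intro s u
    simp [hS, add_mul, Finset.sum_add_distrib, Pi.single_apply]
  unfold HasLineDerivAt
  simp only [hline]
  refine HasDerivAt.ofReal_comp (f := fun s : ℝ => ∫ u, h u * Real.exp (S u + s * a u j) ∂μ) ?_
  -- For `|s| < 1` the exponent is at most `D + C`, which gives the constant bound. The factor `h`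
  -- lets the statement be applied a second time.
  have key := (hasDerivAt_integral_of_dominated_loc_of_deriv_le (μ := μ) (x₀ := (0 : ℝ))
    (F := fun s u => h u * Real.exp (S u + s * a u j))
    (F' := fun s u => (h u * a u j) * Real.exp (S u + s * a u j))
    (bound := fun _ => B * C * Real.exp (D + C)) (Metric.ball_mem_nhds 0 one_pos)
    (Eventually.of_forall fun s => ?_) ?_ ?_ ?_ ?_ ?_).2
  · simpa using key
  · exact (hh.mul (Real.measurable_exp.comp (hSm.add ((ha j).const_mul s)))).aestronglyMeasurable
  · refine Integrable.of_bound (C := B * Real.exp D) ?_ (Eventually.of_forall fun u => ?_)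
    · exact (hh.mul (Real.measurable_exp.comp
        (hSm.add ((ha j).const_mul 0)))).aestronglyMeasurable
    · rw [Real.norm_eq_abs, abs_mul, Real.abs_exp]
      have := hB u
      have h0 : 0 ≤ B := (abs_nonneg _).trans this
      gcongr
      simpa using hSD u
  · exact ((hh.mul (ha j)).mul (Real.measurable_exp.comp
      (hSm.add ((ha j).const_mul 0)))).aestronglyMeasurable
  · refine Eventually.of_forall fun u s hs => ?_
    have hs1 : |s| ≤ 1 := by simpa using (Metric.mem_ball.1 hs).le
    have h1 := hB u
    have h0 : 0 ≤ B := (abs_nonneg _).trans h1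
    have h2 := hC u j
    have h3 : 0 ≤ C := (abs_nonneg _).trans h2
    rw [Real.norm_eq_abs, abs_mul, abs_mul, Real.abs_exp]
    gcongr
    · exact hSD u
    · calc s * a u j ≤ |s * a u j| := le_abs_self _
        _ = |s| * |a u j| := abs_mul _ _
        _ ≤ 1 * C := mul_le_mul hs1 h2 (abs_nonneg _) zero_le_one
        _ = C := one_mul _
  · exact integrable_const _
  · refine Eventually.of_forall fun u s _ => ?_
    have h1 : HasDerivAt (fun s : ℝ => S u + s * a u j) (a u j) s := by
      simpa using ((hasDerivAt_id s).mul_const (a u j)).const_add (S u)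
    refine (h1.exp.const_mul (h u)).congr_deriv ?_
    ring

end Laplace

/-! ### Moment functions as Haar moments of the Iwasawa projection -/

section Moments

variable {F : Type*} [NormedDivisionRing F] [NormedAlgebra ℝ F] [StarRing F] [CStarRing F]
  [FiniteDimensional ℝ F] [hF : Fact (IsRealComplexOrQuaternion F)] {q : ℕ}

variable (F) in
/-- The Iwasawa projection of `e^t u`. -/
def iwasawaConj (t : EuclideanSpace ℝ (Fin q)) (u : U F q) : Fin q → ℝ :=
  diffs (logMinor (star (u : Matrix (Fin q) (Fin q) F) * expDiag F t *
    (u : Matrix (Fin q) (Fin q) F)))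

theorem continuous_iwasawaConj (j : Fin q) :
    Continuous fun p : EuclideanSpace ℝ (Fin q) × U F q => iwasawaConj F p.1 p.2 j :=
  continuous_diffs continuous_logMinor_conj j

theorem abs_iwasawaConj_le (t : EuclideanSpace ℝ (Fin q)) (u : U F q) (j : Fin q) :
    |iwasawaConj F t u j| ≤ 2 * (q * ∑ i, |t i|) :=
  abs_diffs_le (abs_logMinor_conj_le u.2 t) j

theorem measurable_iwasawaConj (t : EuclideanSpace ℝ (Fin q)) (j : Fin q) :
    Measurable fun u : U F q => iwasawaConj F t u j :=
  ((continuous_iwasawaConj j).comp (by fun_prop : Continuous fun u : U F q => (t, u))).measurable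

theorem powerFun_half {x : Matrix (Fin q) (Fin q) F} (hx : ∀ r, 0 < minor x r)
    (lam : Fin q → ℝ) : powerFun (fun l => (lam l : ℂ) / 2) x =
      ((Real.exp (∑ l, lam l * diffs (logMinor x) l) : ℝ) : ℂ) := by
  rw [← sum_mul_sub_next, Real.exp_sum, Complex.ofReal_prod]
  refine Finset.prod_congr rfl fun r _ => ?_
  have h0 : (minor x r : ℂ) ≠ 0 := Complex.ofReal_ne_zero.2 (hx r).ne'
  rw [Complex.cpow_def_of_ne_zero h0, ← Complex.ofReal_log (hx r).le, Complex.ofReal_exp, logMinor]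
  congr 1
  split_ifs with h <;> push_cast <;> ring

/-- Since `i(-iρ - iλ) - ρ = λ`, the shift by `ρ` cancels, and `powerFun_half` turns the integrand
into a real exponential. The moment functions are then read off as derivatives at `λ = 0`. -/
theorem spherical_eq (t : EuclideanSpace ℝ (Fin q)) (lam : Fin q → ℝ) :
    spherical F (fun l => -Complex.I * (rho F q l : ℂ) - Complex.I * (lam l : ℂ)) t =
      ((∫ u, 1 * Real.exp (∑ l, lam l * iwasawaConj F t u l) ∂(haarU F q) : ℝ) : ℂ) := by
  rw [spherical, ← integral_complex_ofReal]
  refine integral_congr_ae (Eventually.of_forall fun u => ?_)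
  have e : (fun l => (Complex.I * (-Complex.I * (rho F q l : ℂ) - Complex.I * (lam l : ℂ)) -
      (rho F q l : ℂ)) / 2) = fun l => (lam l : ℂ) / 2 := by
    ext l
    have : Complex.I * (-Complex.I * (rho F q l : ℂ) - Complex.I * (lam l : ℂ)) =
        -(Complex.I * Complex.I) * (rho F q l + lam l) := by ring
    rw [this, Complex.I_mul_I]
    ring
  simp only [e, one_mul]
  exact powerFun_half (fun r => minor_pos (realDet_leading_conj_pos u.2 t r)) lam

theorem lineDeriv_spherical (t : EuclideanSpace ℝ (Fin q)) (j : Fin q) :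
    (fun lam : Fin q → ℝ => lineDeriv ℝ (fun lam : Fin q → ℝ =>
      spherical F (fun l => -Complex.I * (rho F q l : ℂ) - Complex.I * (lam l : ℂ)) t) lam
      (Pi.single j 1)) = fun lam => ((∫ u, iwasawaConj F t u j *
        Real.exp (∑ l, lam l * iwasawaConj F t u l) ∂(haarU F q) : ℝ) : ℂ) := by
  ext lam
  simp only [spherical_eq]
  have := (hasLineDerivAt_integral_exp (μ := haarU F q) (h := fun _ => 1) measurable_const
    (measurable_iwasawaConj t) (B := 1) (by simp) (abs_iwasawaConj_le t) lam j).lineDeriv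
  simpa only [one_mul] using this

theorem m1_apply (t : EuclideanSpace ℝ (Fin q)) (j : Fin q) :
    m1 F t j = ∫ u, iwasawaConj F t u j ∂(haarU F q) := by
  have h := congrFun (lineDeriv_spherical (F := F) t j) 0
  simp only [m1, momentFun, List.foldr]
  rw [h]
  simp

theorem m2_apply (t : EuclideanSpace ℝ (Fin q)) (j l : Fin q) :
    m2 F t j l = ∫ u, iwasawaConj F t u j * iwasawaConj F t u l ∂(haarU F q) := by
  simp only [m2, momentFun, List.foldr, Matrix.of_apply]
  rw [lineDeriv_spherical]
  have := (hasLineDerivAt_integral_exp (μ := haarU F q) (measurable_iwasawaConj t l)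
    (measurable_iwasawaConj t) (fun u => abs_iwasawaConj_le t u l) (abs_iwasawaConj_le t) 0
    j).lineDeriv
  rw [this]
  simp [mul_comm]

theorem measurable_m1 (j : Fin q) :
    Measurable fun t : EuclideanSpace ℝ (Fin q) => m1 F t j := by
  simp only [m1_apply]
  exact (StronglyMeasurable.integral_prod_right
    (continuous_iwasawaConj j).measurable.stronglyMeasurable).measurable

theorem measurable_m2 (j l : Fin q) :
    Measurable fun t : EuclideanSpace ℝ (Fin q) => m2 F t j l := by
  simp only [m2_apply]
  exact (StronglyMeasurable.integral_prod_right
    ((continuous_iwasawaConj j).mul (continuous_iwasawaConj l)).measurable.stronglyMeasurable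
    ).measurable

theorem abs_m1_le (t : EuclideanSpace ℝ (Fin q)) (j : Fin q) :
    |m1 F t j| ≤ 2 * (q * ∑ i, |t i|) := by
  rw [m1_apply, ← Real.norm_eq_abs]
  refine (norm_integral_le_of_norm_le_const (C := 2 * (q * ∑ i, |t i|))
    (Eventually.of_forall fun u => abs_iwasawaConj_le t u j)).trans ?_
  simp

theorem abs_m2_le (t : EuclideanSpace ℝ (Fin q)) (j l : Fin q) :
    |m2 F t j l| ≤ (2 * (q * ∑ i, |t i|)) ^ 2 := by
  rw [m2_apply, ← Real.norm_eq_abs]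
  refine (norm_integral_le_of_norm_le_const (C := (2 * (q * ∑ i, |t i|)) ^ 2)
    (Eventually.of_forall fun u => ?_)).trans (by simp)
  rw [Real.norm_eq_abs, abs_mul, sq]
  exact mul_le_mul (abs_iwasawaConj_le t u j) (abs_iwasawaConj_le t u l) (abs_nonneg _)
    ((abs_nonneg _).trans (abs_iwasawaConj_le t u j))

/-- Averaging the Iwasawa projection over `U(q, F)` only depends on the singular spectrum. -/
theorem exists_iwasawa_mul_toUnits (g : GL (Fin q) F) : ∃ k : U F q, ∀ (u : U F q) (j : Fin q),
    iwasawa (g * Unitary.toUnits u) j = iwasawaConj F (logSing g) (k * u) j := by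
  obtain ⟨-, k, hk⟩ := exists_logMinorGram_mul_toUnits g
  refine ⟨k, fun u j => ?_⟩
  have : logMinorGram (g * Unitary.toUnits u) = _ := funext (hk u)
  rw [iwasawa, this]
  rfl

/-- The diagonalizing factor `k` disappears by left invariance of Haar measure. -/
theorem m1_logSing (g : GL (Fin q) F) (j : Fin q) :
    m1 F (logSing g) j = ∫ u, iwasawa (g * Unitary.toUnits u) j ∂(haarU F q) := by
  obtain ⟨k, hk⟩ := exists_iwasawa_mul_toUnits g
  simp only [hk, m1_apply]
  exact (integral_mul_left_eq_self (fun u => iwasawaConj F (logSing g) u j) k).symm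

theorem m2_logSing (g : GL (Fin q) F) (j l : Fin q) :
    m2 F (logSing g) j l = ∫ u, iwasawa (g * Unitary.toUnits u) j *
      iwasawa (g * Unitary.toUnits u) l ∂(haarU F q) := by
  obtain ⟨k, hk⟩ := exists_iwasawa_mul_toUnits g
  simp only [hk, m2_apply]
  exact (integral_mul_left_eq_self (fun u => iwasawaConj F (logSing g) u j *
    iwasawaConj F (logSing g) u l) k).symm

theorem abs_iwasawa_le (g : GL (Fin q) F) (j : Fin q) :
    |iwasawa g j| ≤ 2 * (q * ∑ i, |logSing g i|) := by
  obtain ⟨k, hk⟩ := exists_iwasawa_mul_toUnits g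
  have := hk 1 j
  rw [map_one, mul_one] at this
  rw [this]
  exact abs_iwasawaConj_le _ _ _

end Moments

end BiinvariantWalk

end

noncomputable section

/-! ### Leading minors of almost every unitary matrix are nonzero -/

namespace BiinvariantWalk

/-- A set that meets every line through some point in a countable set has Lebesgue measure zero. -/
theorem addHaar_eq_zero_of_countable_lines {E : Type*} [NormedAddCommGroup E] [NormedSpace ℝ E]
    [FiniteDimensional ℝ E] [MeasurableSpace E] [BorelSpace E] (μ : Measure E)
    [μ.IsAddHaarMeasure] {A : Set E} (hA : MeasurableSet A) (z₀ : E)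
    (h : ∀ z, {s : ℝ | z₀ + s • z ∈ A}.Countable) : μ A = 0 := by
  set A' : Set E := (fun z => z₀ + z) ⁻¹' A with hA'
  have hA'm : MeasurableSet A' := (measurable_const_add z₀) hA
  have hAA' : μ A' = μ A := measure_preimage_add μ z₀ A
  -- By Fubini `S` is null, since for fixed `z` its slices are countable. Hence for some `s ≠ 0` the
  -- preimage of `A'` under dilation by `s` is null, and so is `A'`.
  set S : Set (E × ℝ) := {p | p.2 • p.1 ∈ A'} with hS
  have hSm : MeasurableSet S := by
    have : Measurable fun p : E × ℝ => p.2 • p.1 := by fun_prop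
    exact this hA'm
  have h1 : (μ.prod (volume : Measure ℝ)) S = 0 := by
    rw [Measure.measure_prod_null hSm]
    exact Eventually.of_forall fun z => (h z).measure_zero _
  have h2 : ((volume : Measure ℝ).prod μ) (Prod.swap ⁻¹' S) = 0 := by
    rw [(Measure.measurePreserving_swap).measure_preimage hSm.nullMeasurableSet, h1]
  have h3 := Measure.measure_ae_null_of_prod_null h2
  obtain ⟨s, hs, hs0⟩ : ∃ s : ℝ, μ ((fun z => s • z) ⁻¹' A') = 0 ∧ s ≠ 0 := by
    have hne : ∀ᵐ s : ℝ, s ≠ 0 := by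
      rw [ae_iff]; simp
    obtain ⟨s, hs⟩ := (h3.and hne).exists
    exact ⟨s, hs.1, hs.2⟩
  rw [Measure.addHaar_preimage_smul μ hs0] at hs
  rcases mul_eq_zero.1 hs with h4 | h4
  · exfalso
    rw [ENNReal.ofReal_eq_zero] at h4
    have : 0 < |(s ^ Module.finrank ℝ E)⁻¹| := abs_pos.2 (inv_ne_zero (pow_ne_zero _ hs0))
    linarith
  · rw [← hAA', h4]

section HaarNull

variable {F : Type*} [NormedDivisionRing F] [NormedAlgebra ℝ F] [StarRing F] [CStarRing F]
  [FiniteDimensional ℝ F]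

/-- In a real basis the determinant is a polynomial in `s` that does not vanish at `0`. -/
theorem countable_realDet_add_smul_eq_zero {n : Type*} [Fintype n] [DecidableEq n]
    (M N : Matrix n n F) (hM : realDet M ≠ 0) : {s : ℝ | realDet (M + s • N) = 0}.Countable := by
  set b := Module.finBasis ℝ (n → F)
  set M' := LinearMap.toMatrix b b (realLin M)
  set N' := LinearMap.toMatrix b b (realLin N)
  set p : Polynomial ℝ := (M'.map (⇑(Polynomial.C (R := ℝ))) +
    (Polynomial.X : Polynomial ℝ) • N'.map (⇑(Polynomial.C (R := ℝ)))).det with hp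
  have heval : ∀ s : ℝ, p.eval s = realDet (M + s • N) := by
    intro s
    rw [hp, ← Polynomial.coe_evalRingHom, RingHom.map_det, realDet, ← LinearMap.det_toMatrix b,
      realLin_add, realLin_smul, map_add (LinearMap.toMatrix b b),
      map_smul (LinearMap.toMatrix b b)]
    congr 1
    ext i j
    change Polynomial.eval s (Polynomial.C (M' i j) + Polynomial.X * Polynomial.C (N' i j)) =
      M' i j + s * N' i j
    simp only [Polynomial.eval_add, Polynomial.eval_mul, Polynomial.eval_C, Polynomial.eval_X]
  have hp0 : p ≠ 0 := by
    intro h0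
    have := heval 0
    rw [h0, zero_smul, add_zero, Polynomial.eval_zero] at this
    exact hM this.symm
  refine ((Polynomial.finite_setOfPred_isRoot hp0).subset fun s hs => ?_).countable
  rw [Set.mem_ofPred_eq, Polynomial.IsRoot, heval]
  exact hs

variable [hF : Fact (IsRealComplexOrQuaternion F)] {q : ℕ}

theorem leading_one (r : Fin q) : leading (1 : Matrix (Fin q) (Fin q) F) r = 1 := by
  ext i j; simp [toBlock_apply, one_apply, Subtype.ext_iff]

/-- The leading minors of almost every unitary matrix do not vanish. -/
theorem haarU_realDet_leading_eq_zero (r : Fin q) :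
    haarU F q {u | realDet (leading (u : Matrix (Fin q) (Fin q) F) r) = 0} = 0 := by
  have : ProperSpace F := FiniteDimensional.proper_real F
  let : MeasurableSpace F := borel F
  have : BorelSpace F := ⟨rfl⟩
  set μ : Measure (Fin q → Fin q → F) := Measure.addHaar
  -- The null set of Haar measure is reached through Lebesgue measure on all matrices `Z`. For fixed
  -- `u`, the minor of `Zu` is nonzero at `Z = u*`, so it vanishes on a null set of `Z`; by Fubini
  -- one `Z` serves almost every `u`.
  set S : Set (U F q × (Fin q → Fin q → F)) :=
    {p | realDet (leading (Matrix.of p.2 * (p.1 : Matrix (Fin q) (Fin q) F)) r) = 0} with hS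
  have hcont : Continuous fun p : U F q × (Fin q → Fin q → F) =>
      realDet (leading (Matrix.of p.2 * (p.1 : Matrix (Fin q) (Fin q) F)) r) := by
    refine continuous_realDet.comp ((continuous_leading r).comp ?_)
    have h1 : Continuous fun p : U F q × (Fin q → Fin q → F) =>
      (Matrix.of p.2 : Matrix (Fin q) (Fin q) F) := continuous_snd
    exact h1.matrix_mul (continuous_subtype_val.comp continuous_fst)
  have hSm : MeasurableSet S := (isClosed_singleton.preimage hcont).measurableSet
  have h1 : ((haarU F q).prod μ) S = 0 := by
    rw [Measure.measure_prod_null hSm]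
    refine Eventually.of_forall fun u => ?_
    refine addHaar_eq_zero_of_countable_lines μ (measurable_prodMk_left hSm)
      ((u : Matrix (Fin q) (Fin q) F)ᴴ) fun z => ?_
    have hone : realDet (leading (star (u : Matrix (Fin q) (Fin q) F) *
        (u : Matrix (Fin q) (Fin q) F)) r) ≠ 0 := by
      rw [(Unitary.mem_iff.1 u.2).1, leading_one, realDet_one]
      exact one_ne_zero
    refine (countable_realDet_add_smul_eq_zero _ 
      (leading (Matrix.of z * (u : Matrix (Fin q) (Fin q) F)) r) hone).mono ?_
    intro s hs
    rw [Set.mem_ofPred_eq, Set.mem_preimage, hS, Set.mem_ofPred_eq] at hs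
    have hs' : realDet (leading ((star (u : Matrix (Fin q) (Fin q) F) + s • Matrix.of z) *
      (u : Matrix (Fin q) (Fin q) F)) r) = 0 := by
      convert hs using 4
      ext i j
      rfl
    rw [add_mul, smul_mul_assoc] at hs'
    exact hs'
  have h2 : (μ.prod (haarU F q)) (Prod.swap ⁻¹' S) = 0 := by
    rw [(Measure.measurePreserving_swap).measure_preimage hSm.nullMeasurableSet, h1]
  obtain ⟨z, hz⟩ := (Measure.measure_ae_null_of_prod_null h2).exists
  set Z : Matrix (Fin q) (Fin q) F := Matrix.of z
  have hz' : haarU F q {u | realDet (leading (Z * (u : Matrix (Fin q) (Fin q) F)) r) = 0} = 0 := hz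
  -- Now `Z = τ* v` with `τ*` lower triangular, so the block of `Zu` is that of `τ*` times that of
  -- `vu`. Zeros for `vu` are zeros for `Zu`, and left invariance removes `v`.
  obtain ⟨v, hv, hτ⟩ := exists_unitary_mul_upperTriangular Zᴴ
  set τ := v * Zᴴ with hτZ
  have hZ : Z = τᴴ * v := by
    rw [hτZ, conjTranspose_mul, conjTranspose_conjTranspose, mul_assoc, ← star_eq_conjTranspose,
      (Unitary.mem_iff.1 hv).1, mul_one]
  have h3 : τᴴ.toBlock (· ≤ r) (fun i => ¬ i ≤ r) = 0 := by
    ext i j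
    have := hτ j i (lt_of_le_of_lt i.2 (not_le.1 j.2))
    simp [toBlock_apply, this]
  rw [← measure_preimage_mul (haarU F q) (⟨v, hv⟩ : U F q)]
  refine measure_mono_null (fun u hu => ?_) hz'
  have hu' : realDet (leading (v * (u : Matrix (Fin q) (Fin q) F)) r) = 0 := hu
  rw [Set.mem_ofPred_eq, hZ, mul_assoc, leading, toBlock_mul_eq_add', h3, Matrix.zero_mul, add_zero,
    realDet_mul]
  exact mul_eq_zero_of_right _ hu'

end HaarNull

end BiinvariantWalk

end

noncomputable section

namespace BiinvariantWalk

/-! ### Invariant laws: additivity of the projection and control of the defect -/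

section Invariance

variable {F : Type*} [NormedDivisionRing F] [NormedAlgebra ℝ F] [StarRing F] [CStarRing F]
  [FiniteDimensional ℝ F] [hF : Fact (IsRealComplexOrQuaternion F)] {q : ℕ}
  {μ ν : Measure (GL (Fin q) F)} [IsProbabilityMeasure μ] [IsProbabilityMeasure ν]

/-- Invariance of a measure on `GL(q, F)` under right multiplication with `U(q, F)`. -/
def IsRightInvariant (μ : Measure (GL (Fin q) F)) : Prop :=
  ∀ u : U F q, μ.map (fun g => g * Unitary.toUnits u) = μ

theorem measurable_mul_toUnits :
    Measurable fun p : GL (Fin q) F × U F q => p.1 * Unitary.toUnits p.2 :=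
  measurable_fst.mul (continuous_toUnits.measurable.comp measurable_snd)

theorem IsRightInvariant.measurePreserving_mul (hμ : IsRightInvariant μ) :
    MeasurePreserving (fun p : GL (Fin q) F × U F q => p.1 * Unitary.toUnits p.2)
      (μ.prod (haarU F q)) μ := by
  refine ⟨measurable_mul_toUnits, Measure.ext fun s hs => ?_⟩
  rw [Measure.map_apply measurable_mul_toUnits hs,
    Measure.prod_apply_symm (measurable_mul_toUnits hs)]
  have : ∀ u : U F q, μ ((fun g => (g, u)) ⁻¹'
      ((fun p : GL (Fin q) F × U F q => p.1 * Unitary.toUnits p.2) ⁻¹' s)) = μ s := by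
    intro u
    conv_rhs => rw [← hμ u, Measure.map_apply (measurable_mul_const _) hs]
    rfl
  simp [this]

theorem IsRightInvariant.integral_integral_mul (hμ : IsRightInvariant μ) {f : GL (Fin q) F → ℝ}
    (hf : Integrable f μ) :
    ∫ g, ∫ u, f (g * Unitary.toUnits u) ∂(haarU F q) ∂μ = ∫ g, f g ∂μ := by
  have hmp := hμ.measurePreserving_mul
  have hfi : Integrable (fun p : GL (Fin q) F × U F q => f (p.1 * Unitary.toUnits p.2))
      (μ.prod (haarU F q)) := hmp.integrable_comp_of_integrable hf
  rw [← integral_prod (fun p : GL (Fin q) F × U F q => f (p.1 * Unitary.toUnits p.2)) hfi]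
  have := integral_map (μ := μ.prod (haarU F q)) hmp.measurable.aemeasurable
    (f := f) (by rw [hmp.map_eq]; exact hf.aestronglyMeasurable)
  rw [hmp.map_eq] at this
  exact this.symm

theorem IsRightInvariant.map_mul (hν : IsRightInvariant ν) :
    IsRightInvariant ((μ.prod ν).map fun p => p.1 * p.2) := by
  intro u
  have hm : Measurable fun p : GL (Fin q) F × GL (Fin q) F => p.1 * p.2 := measurable_mul
  rw [Measure.map_map (measurable_mul_const _) hm]
  have h1 : ((fun g => g * Unitary.toUnits u) ∘ fun p : GL (Fin q) F × GL (Fin q) F => p.1 * p.2) =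
      (fun p : GL (Fin q) F × GL (Fin q) F => p.1 * p.2) ∘
        Prod.map id (fun g => g * Unitary.toUnits u) := by
    ext1 p
    simp [mul_assoc]
  rw [h1, ← Measure.map_map hm (measurable_id.prodMap (measurable_mul_const _)),
    ← Measure.map_prod_map _ _ measurable_id (measurable_mul_const _), hν u, Measure.map_id]

/-- The Iwasawa projection is additive in distribution for independent factors, the left one of
which is invariant. -/
theorem IsRightInvariant.map_iwasawa_mul (hμ : IsRightInvariant μ) :
    ((μ.prod ν).map fun p => p.1 * p.2).map iwasawa = (μ.map iwasawa) ∗ (ν.map iwasawa) := by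
  have hm : Measurable fun p : GL (Fin q) F × GL (Fin q) F => p.1 * p.2 := measurable_mul
  have hH : Measurable (iwasawa : GL (Fin q) F → EuclideanSpace ℝ (Fin q)) :=
    continuous_iwasawa.measurable
  rw [Measure.conv, Measure.map_prod_map _ _ hH hH, Measure.map_map hH hm,
    Measure.map_map measurable_add (hH.prodMap hH)]
  refine Measure.ext fun s hs => ?_
  rw [Measure.map_apply (hH.comp hm) hs, Measure.map_apply (measurable_add.comp (hH.prodMap hH)) hs,
    Measure.prod_apply_symm ((hH.comp hm) hs),
    Measure.prod_apply_symm ((measurable_add.comp (hH.prodMap hH)) hs)]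
  refine lintegral_congr fun x => ?_
  -- The right factor `x` is held fixed, so `κ` is constant and the invariance of `μ` removes it.
  obtain ⟨κ, hκ⟩ := exists_iwasawa_mul x
  have hms : MeasurableSet {g : GL (Fin q) F | iwasawa g + iwasawa x ∈ s} :=
    (hH.add_const _) hs
  calc μ {g | iwasawa (g * x) ∈ s}
      = μ ((fun g => g * Unitary.toUnits κ) ⁻¹' {g | iwasawa g + iwasawa x ∈ s}) := by
        simp only [hκ]; rfl
    _ = μ {g | iwasawa g + iwasawa x ∈ s} := by
        rw [← Measure.map_apply (measurable_mul_const _) hms, hμ κ]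

/-- The defect between the partial sums of the singular spectrum and of the Iwasawa projection. -/
def defect (g : GL (Fin q) F) (r : Fin q) : ℝ :=
  ∑ i ∈ Finset.Iic r, logSing g i - logMinorGram g r

/-- A bound for the defect of `e^t u` that does not depend on `t`. -/
def defectBound (r : Fin q) (u : U F q) : ℝ :=
  -(Real.log (realDet ((leading (u : Matrix (Fin q) (Fin q) F) r)ᴴ *
    leading (u : Matrix (Fin q) (Fin q) F) r)) / (2 * Module.finrank ℝ F))

theorem measurable_defect (r : Fin q) : Measurable fun g : GL (Fin q) F => defect g r := by
  refine (Finset.measurable_fun_sum _ fun i _ => ?_).sub (continuous_logMinorGram r).measurable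
  exact (EuclideanSpace.proj i).continuous.measurable.comp measurable_logSing

theorem measurable_defectBound (r : Fin q) : Measurable (defectBound (F := F) r) := by
  have h1 : Continuous fun u : U F q => leading (u : Matrix (Fin q) (Fin q) F) r :=
    (continuous_leading r).comp continuous_subtype_val
  have h2 := continuous_realDet.comp (h1.matrix_conjTranspose.matrix_mul h1)
  exact ((Real.measurable_log.comp h2.measurable).div_const _).neg

theorem defect_nonneg (g : GL (Fin q) F) (r : Fin q) : 0 ≤ defect g r := by
  have := logMinorGram_le_sum_logSing g 1 r
  rw [map_one, mul_one] at this
  exact sub_nonneg.2 this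

theorem sum_logSing_mul_toUnits (g : GL (Fin q) F) (u : U F q) (r : Fin q) :
    ∑ i ∈ Finset.Iic r, logSing (g * Unitary.toUnits u) i = ∑ i ∈ Finset.Iic r, logSing g i := by
  rw [sum_logSing_eq_iSup, sum_logSing_eq_iSup]
  refine (Equiv.mulLeft u).iSup_congr fun v => ?_
  rw [Equiv.coe_mulLeft, map_mul, mul_assoc]

theorem exists_defect_le (g : GL (Fin q) F) (r : Fin q) : ∃ k : U F q, ∀ u : U F q,
    realDet (leading ((k * u : U F q) : Matrix (Fin q) (Fin q) F) r) ≠ 0 →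
      defect (g * Unitary.toUnits u) r ≤ defectBound r (k * u) := by
  obtain ⟨-, k, hk⟩ := exists_logMinorGram_mul_toUnits g
  refine ⟨k, fun u h => ?_⟩
  rw [defect, sum_logSing_mul_toUnits, hk, defectBound]
  linarith [le_logMinor_conj (k * u).2 (logSing g) r h]

/-- Replacing `g` by `g u` with `u` Haar distributed keeps the law. The defect is then at most
`defectBound` at `k u`, again Haar distributed, so the bound is the same for every right invariant
law and hence for all times of the walk. -/
theorem IsRightInvariant.measure_defect_le (hμ : IsRightInvariant μ) (r : Fin q) (ε : ℝ) {s : ℝ}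
    (hs : 0 ≤ s) : μ {g | ε ≤ s * defect g r} ≤ haarU F q {u | ε ≤ s * defectBound r u} := by
  have hms : MeasurableSet {g : GL (Fin q) F | ε ≤ s * defect g r} :=
    measurableSet_le measurable_const ((measurable_defect r).const_mul s)
  rw [← hμ.measurePreserving_mul.measure_preimage hms.nullMeasurableSet,
    Measure.prod_apply (measurable_mul_toUnits hms)]
  calc _ ≤ ∫⁻ _, haarU F q {u | ε ≤ s * defectBound r u} ∂μ := lintegral_mono fun g => ?_
    _ = _ := by simp
  obtain ⟨k, hk⟩ := exists_defect_le g r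
  rw [← measure_preimage_mul (haarU F q) k {u | ε ≤ s * defectBound r u}]
  refine measure_mono_ae ?_
  have hnull : ∀ᵐ u ∂(haarU F q),
      realDet (leading ((k * u : U F q) : Matrix (Fin q) (Fin q) F) r) ≠ 0 := by
    rw [ae_iff]
    simp only [not_not]
    have := haarU_realDet_leading_eq_zero (F := F) r
    rw [← measure_preimage_mul (haarU F q) k] at this
    exact this
  filter_upwards [hnull] with u hu h
  exact le_trans h (mul_le_mul_of_nonneg_left (hk u hu) hs)

/-- A fixed real function divided by `√k` tends to zero pointwise, hence in measure. -/
theorem tendsto_haarU_defectBound (r : Fin q) {ε : ℝ} (hε : 0 < ε) :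
    Tendsto (fun k : ℕ => haarU F q {u | ε ≤ (√(k : ℝ))⁻¹ * defectBound r u}) atTop (𝓝 0) := by
  have h : TendstoInMeasure (haarU F q) (fun (k : ℕ) u => (√(k : ℝ))⁻¹ * defectBound (F := F) r u)
      atTop (fun _ => 0) := by
    refine tendstoInMeasure_of_tendsto_ae
      (fun k => ((measurable_defectBound r).const_mul _).aestronglyMeasurable)
      (Eventually.of_forall fun u => ?_)
    have h0 : Tendsto (fun k : ℕ => (√(k : ℝ))⁻¹) atTop (𝓝 0) :=
      tendsto_inv_atTop_zero.comp (Real.tendsto_sqrt_atTop.comp tendsto_natCast_atTop_atTop)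
    simpa using h0.mul_const (defectBound r u)
  rw [tendstoInMeasure_iff_norm] at h
  refine tendsto_of_tendsto_of_tendsto_of_le_of_le tendsto_const_nhds (h ε hε) (fun _ => zero_le)
    fun k => measure_mono fun u hu => ?_
  have hu' : ε ≤ (√(k : ℝ))⁻¹ * defectBound r u := hu
  change ε ≤ ‖(√(k : ℝ))⁻¹ * defectBound r u - 0‖
  rw [sub_zero]
  exact hu'.trans (le_abs_self _)

theorem norm_logSing_sub_iwasawa_le {g : GL (Fin q) F} {a : ℝ} (h : ∀ r, defect g r ≤ a) :
    ‖logSing g - iwasawa g‖ ≤ q * (2 * a) := by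
  have hcoord : ∀ j, |(logSing g - iwasawa g) j| ≤ 2 * a := by
    intro j
    have e : (logSing g - iwasawa g) j = diffs (defect g) j := by
      have : defect g = (fun r => ∑ i ∈ Finset.Iic r, logSing g i) - logMinorGram g := rfl
      rw [this, diffs_sub, diffs_sum_Iic]
      rfl
    rw [e]
    exact abs_diffs_le (fun r => by rw [abs_of_nonneg (defect_nonneg g r)]; exact h r) j
  rcases Nat.eq_zero_or_pos q with h0 | h0
  · subst h0
    simp [Subsingleton.elim (logSing g - iwasawa g) 0]
  have ha : 0 ≤ 2 * a := (abs_nonneg _).trans (hcoord ⟨0, h0⟩)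
  have hq1 : (1 : ℝ) ≤ q := by exact_mod_cast h0
  rw [EuclideanSpace.norm_eq, Real.sqrt_le_iff]
  refine ⟨by positivity, ?_⟩
  calc ∑ j, ‖(logSing g - iwasawa g) j‖ ^ 2 ≤ ∑ _j : Fin q, (2 * a) ^ 2 :=
        Finset.sum_le_sum fun j _ => pow_le_pow_left₀ (norm_nonneg _) (hcoord j) 2
    _ = q * (2 * a) ^ 2 := by simp
    _ ≤ (q * (2 * a)) ^ 2 := by
        rw [mul_pow (q : ℝ)]
        exact mul_le_mul_of_nonneg_right (by nlinarith) (sq_nonneg _)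

end Invariance

/-! ### The random walk -/

section Walk

variable {F : Type*} [NormedDivisionRing F] [NormedAlgebra ℝ F] [StarRing F] [CStarRing F]
  [FiniteDimensional ℝ F] {q : ℕ} {Ω : Type*}

theorem walk_congr {Ω' : Type*} {X : ℕ → Ω → GL (Fin q) F} {Y : ℕ → Ω' → GL (Fin q) F} {ω : Ω}
    {ω' : Ω'} {k : ℕ} (h : ∀ i < k, X i ω = Y i ω') : walk X k ω = walk Y k ω' := by
  induction k with
  | zero => rfl
  | succ k ih =>
    simp only [walk]
    rw [ih fun i hi => h i (by omega), h k (by omega)]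

variable [MeasurableSpace Ω] {P : Measure Ω}

theorem measurable_walk {X : ℕ → Ω → GL (Fin q) F} (hX : ∀ k, Measurable (X k)) (k : ℕ) :
    Measurable (walk X k) := by
  induction k with
  | zero => exact measurable_const
  | succ k ih => exact ih.mul (hX k)

theorem indepFun_walk {X : ℕ → Ω → GL (Fin q) F} (hX : ∀ k, Measurable (X k))
    (hind : iIndepFun X P) (k : ℕ) : IndepFun (walk X k) (X k) P := by
  have h := hind.indepFun_finset (Finset.range k) {k} (by simp) hX
  -- This exhibits `walk X k` as a measurable function of the first `k` increments; the default `1`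
  -- is never read by `walk Y k`.
  set Y : ℕ → (Finset.range k → GL (Fin q) F) → GL (Fin q) F :=
    fun i x => if h : i ∈ Finset.range k then x ⟨i, h⟩ else 1 with hY
  have hYm : ∀ i, Measurable (Y i) := by
    intro i
    by_cases hi : i ∈ Finset.range k
    · simp only [hY, hi, dif_pos]
      exact measurable_pi_apply _
    · simp only [hY, hi, dif_neg, not_false_iff]
      exact measurable_const
  have h2 := h.comp (measurable_walk hYm k)
    (measurable_pi_apply (⟨k, Finset.mem_singleton_self k⟩ : ({k} : Finset ℕ)))
  have e : walk Y k ∘ (fun a (i : Finset.range k) => X i a) = walk X k := by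
    ext1 ω
    refine walk_congr fun i hi => ?_
    simp [hY, hi]
  rw [e] at h2
  exact h2

theorem map_walk_succ [IsProbabilityMeasure P] {X : ℕ → Ω → GL (Fin q) F}
    (hX : ∀ k, Measurable (X k)) (hind : iIndepFun X P) (k : ℕ) :
    P.map (walk X (k + 1)) = ((P.map (walk X k)).prod (P.map (X k))).map fun p => p.1 * p.2 := by
  rw [← (indepFun_iff_map_prod_eq_prod_map_map (measurable_walk hX k).aemeasurable
    (hX k).aemeasurable).1 (indepFun_walk hX hind k),
    Measure.map_map measurable_mul ((measurable_walk hX k).prodMk (hX k))]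
  rfl

variable [hF : Fact (IsRealComplexOrQuaternion F)] [IsProbabilityMeasure P]
  {X : ℕ → Ω → GL (Fin q) F} {νG : Measure (GL (Fin q) F)}

theorem isRightInvariant_map_walk_succ (hX : ∀ k, Measurable (X k)) (hind : iIndepFun X P)
    (hlaw : ∀ k, P.map (X k) = νG) (hinv : IsRightInvariant νG) (k : ℕ) :
    IsRightInvariant (P.map (walk X (k + 1))) := by
  have h1 : IsProbabilityMeasure (P.map (walk X k)) :=
    Measure.isProbabilityMeasure_map (measurable_walk hX k).aemeasurable
  have h2 : IsProbabilityMeasure (P.map (X k)) :=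
    Measure.isProbabilityMeasure_map (hX k).aemeasurable
  rw [map_walk_succ hX hind]
  refine IsRightInvariant.map_mul ?_
  rw [hlaw k]; exact hinv

/-- The induction starts after one step because the unit mass at `S_0 = 1` is in general not right
invariant. -/
theorem charFun_map_iwasawa_walk (hX : ∀ k, Measurable (X k)) (hind : iIndepFun X P)
    (hlaw : ∀ k, P.map (X k) = νG) (hinv : IsRightInvariant νG) (k : ℕ)
    (t : EuclideanSpace ℝ (Fin q)) :
    charFun ((P.map (walk X (k + 1))).map iwasawa) t =
      charFun (νG.map iwasawa) t ^ (k + 1) := by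
  induction k with
  | zero =>
    have : walk X (0 + 1) = X 0 := by
      ext1 ω; simp [walk]
    rw [this, hlaw, zero_add, pow_one]
  | succ k ih =>
    have h1 : IsProbabilityMeasure (P.map (walk X (k + 1))) :=
      Measure.isProbabilityMeasure_map (measurable_walk hX _).aemeasurable
    have h2 : IsProbabilityMeasure (P.map (X (k + 1))) :=
      Measure.isProbabilityMeasure_map (hX _).aemeasurable
    have h3 := (isRightInvariant_map_walk_succ hX hind hlaw hinv k).map_iwasawa_mul
      (ν := P.map (X (k + 1)))
    have h4 : IsProbabilityMeasure ((P.map (walk X (k + 1))).map iwasawa) :=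
      Measure.isProbabilityMeasure_map continuous_iwasawa.measurable.aemeasurable
    have h5 : IsProbabilityMeasure ((P.map (X (k + 1))).map iwasawa) :=
      Measure.isProbabilityMeasure_map continuous_iwasawa.measurable.aemeasurable
    rw [map_walk_succ hX hind, h3, charFun_conv, ih, hlaw, pow_succ _ (k + 1)]

theorem tendstoInMeasure_logSing_sub_iwasawa (hX : ∀ k, Measurable (X k)) (hind : iIndepFun X P)
    (hlaw : ∀ k, P.map (X k) = νG) (hinv : IsRightInvariant νG) :
    TendstoInMeasure P (fun (k : ℕ) ω => (√(k : ℝ))⁻¹ •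
      (logSing (walk X k ω) - iwasawa (walk X k ω))) atTop 0 := by
  rw [tendstoInMeasure_iff_norm]
  intro ε hε
  -- If all defects are at most `√k η`, the normalized difference has norm at most `2qη < ε`; the `+
  -- 1` keeps the denominator positive for `q = 0`.
  set η : ℝ := ε / (2 * q + 1) / 2 with hη
  have hη0 : 0 < η := by positivity
  have hlim : Tendsto (fun k : ℕ => ∑ r : Fin q,
      haarU F q {u | η ≤ (√(k : ℝ))⁻¹ * defectBound r u}) atTop (𝓝 0) := by
    simpa using tendsto_finsetSum Finset.univ fun r _ => tendsto_haarU_defectBound (F := F) r hη0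
  refine tendsto_of_tendsto_of_tendsto_of_le_of_le' tendsto_const_nhds hlim
    (Eventually.of_forall fun _ => zero_le) ?_
  filter_upwards [eventually_ge_atTop 1] with k hk
  obtain ⟨m, rfl⟩ : ∃ m, k = m + 1 := ⟨k - 1, by omega⟩
  have hprob : IsProbabilityMeasure (P.map (walk X (m + 1))) :=
    Measure.isProbabilityMeasure_map (measurable_walk hX _).aemeasurable
  have hs : 0 < √((m + 1 : ℕ) : ℝ) := Real.sqrt_pos.2 (by positivity)
  set s := (√((m + 1 : ℕ) : ℝ))⁻¹ with hsdef
  have hs0 : 0 < s := inv_pos.2 hs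
  have hsub : {ω | ε ≤ ‖s • (logSing (walk X (m + 1) ω) - iwasawa (walk X (m + 1) ω)) -
      (0 : Ω → EuclideanSpace ℝ (Fin q)) ω‖} ⊆
      ⋃ r : Fin q, walk X (m + 1) ⁻¹' {g | η ≤ s * defect g r} := by
    intro ω hω
    by_contra hcon
    simp only [Set.mem_iUnion, Set.mem_preimage, Set.mem_ofPred_eq, not_exists, not_le] at hcon
    have h1 : ∀ r, defect (walk X (m + 1) ω) r ≤ s⁻¹ * η := fun r => by
      rw [le_inv_mul_iff₀ hs0]; exact (hcon r).le
    have h2 := norm_logSing_sub_iwasawa_le h1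
    have h3 : ε ≤ ‖s • (logSing (walk X (m + 1) ω) - iwasawa (walk X (m + 1) ω)) -
      (0 : Ω → EuclideanSpace ℝ (Fin q)) ω‖ := hω
    rw [Pi.zero_apply, sub_zero, norm_smul, Real.norm_of_nonneg hs0.le] at h3
    have h4 : s * (q * (2 * (s⁻¹ * η))) = 2 * q * η := by field_simp
    have h5 := h3.trans (mul_le_mul_of_nonneg_left h2 hs0.le)
    rw [h4, hη] at h5
    have h6 : 2 * (q : ℝ) * (ε / (2 * q + 1) / 2) < ε := by
      have h7 : (0 : ℝ) ≤ q := Nat.cast_nonneg q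
      rw [div_div, mul_div_assoc', div_lt_iff₀ (by positivity)]
      nlinarith
    linarith
  refine (measure_mono hsub).trans ((measure_iUnion_fintype_le _ _).trans
    (Finset.sum_le_sum fun r _ => ?_))
  rw [← Measure.map_apply (measurable_walk hX _)
    (measurableSet_le measurable_const ((measurable_defect r).const_mul s))]
  exact (isRightInvariant_map_walk_succ hX hind hlaw hinv m).measure_defect_le r η hs0.le

end Walk

end BiinvariantWalk

end

noncomputable section

/-! ### Characteristic functions and the one-dimensional limit -/

namespace BiinvariantWalk

/-- The limit in the central limit theorem in one dimension, for a centered variable with arbitrary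
variance. -/
theorem tendsto_charFun_inv_sqrt_pow {Ω : Type*} [MeasurableSpace Ω] {P : Measure Ω}
    [IsProbabilityMeasure P] {ξ : Ω → ℝ} (hξ : MemLp ξ 2 P) (h0 : ∫ ω, ξ ω ∂P = 0) :
    Tendsto (fun n : ℕ => charFun (P.map ξ) (√(n : ℝ))⁻¹ ^ n) atTop
      (𝓝 (Complex.exp (-((∫ ω, ξ ω ^ 2 ∂P : ℝ) : ℂ) / 2))) := by
  set v := ∫ ω, ξ ω ^ 2 ∂P with hv
  have hm : AEMeasurable ξ P := hξ.aestronglyMeasurable.aemeasurable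
  have hv0 : 0 ≤ v := integral_nonneg fun ω => sq_nonneg _
  -- A degenerate `ξ` vanishes almost surely; otherwise `ξ` is rescaled to unit variance.
  rcases hv0.eq_or_lt with h | h
  · have h1 : ξ =ᵐ[P] fun _ => 0 := by
      have h2 := (integral_eq_zero_iff_of_nonneg (fun ω => sq_nonneg (ξ ω))
        hξ.integrable_sq).1 (hv.symm.trans h.symm)
      filter_upwards [h2] with ω hω
      exact pow_eq_zero_iff two_ne_zero |>.1 hω
    rw [← h, Measure.map_congr h1, Measure.map_const]
    simp [charFun_dirac]
  · have hsv : 0 < √v := Real.sqrt_pos.2 h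
    have e : ξ = fun ω => √v * (ξ ω / √v) := by
      ext ω; field_simp
    have key := tendsto_charFun_inv_sqrt_mul_pow (P := P) (X := fun ω => ξ ω / √v)
      (hm.div_const _) (by rw [integral_div, h0, zero_div]) (by
        simp only [Pi.pow_apply, div_pow]
        rw [integral_div, ← hv, Real.sq_sqrt hv0, div_self h.ne']) (√v)
    have e2 : -((√v : ℝ) : ℂ) ^ 2 / 2 = -(v : ℂ) / 2 := by
      rw [← Complex.ofReal_pow, Real.sq_sqrt hv0]
    rw [e2] at key
    refine key.congr fun n => ?_
    conv_rhs => rw [e, charFun_map_mul_comp (hm.div_const _), mul_comm]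

theorem charFun_map_sub_smul {Ω E : Type*} [MeasurableSpace Ω] {P : Measure Ω}
    [NormedAddCommGroup E] [InnerProductSpace ℝ E] [MeasurableSpace E] [BorelSpace E]
    [SecondCountableTopology E]
    {Y : Ω → E} (hY : AEMeasurable Y P) (c : E) (s : ℝ) (t : E) :
    charFun (P.map fun ω => s • (Y ω - c)) t =
      charFun (P.map Y) (s • t) * Complex.exp ((inner ℝ (-c) (s • t) : ℝ) * Complex.I) := by
  rw [charFun_map_smul_comp (hY.sub_const c), ← charFun_map_add_const,
    AEMeasurable.map_map_of_aemeasurable (by fun_prop) hY]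
  simp only [Function.comp_def, sub_eq_add_neg]

/-- The right side agrees with that of `charFun_map_sub_smul`, which reduces the vector-valued limit
to scalar projections. -/
theorem charFun_map_inner_sub {Ω E : Type*} [MeasurableSpace Ω] {P : Measure Ω}
    [NormedAddCommGroup E] [InnerProductSpace ℝ E] [MeasurableSpace E] [BorelSpace E]
    [SecondCountableTopology E]
    {Y : Ω → E} (hY : AEMeasurable Y P) (c : E) (s : ℝ) (t : E) :
    charFun (P.map fun ω => inner ℝ (Y ω - c) t) s =
      charFun (P.map Y) (s • t) * Complex.exp ((inner ℝ (-c) (s • t) : ℝ) * Complex.I) := by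
  have h1 : AEMeasurable (fun ω => Y ω - c) P := hY.sub_const c
  have h2 : AEMeasurable (fun ω => (inner ℝ (Y ω - c) t : ℝ)) P := h1.inner_const
  rw [← charFun_map_sub_smul hY, charFun_map_smul_comp h1, charFun_apply, charFun_apply,
    integral_map h2 (by fun_prop), integral_map h1 (by fun_prop)]
  refine integral_congr_ae (Eventually.of_forall fun ω => ?_)
  simp [inner_smul_right]

/-! ### Mean and covariance of the Iwasawa projection -/

section MomentsOfLaw

variable {F : Type*} [NormedDivisionRing F] [NormedAlgebra ℝ F] [StarRing F] [CStarRing F]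
  [FiniteDimensional ℝ F] [hF : Fact (IsRealComplexOrQuaternion F)] {q : ℕ}
  {νG : Measure (GL (Fin q) F)} [IsProbabilityMeasure νG]

theorem memLp_sum_abs {ν : Measure (EuclideanSpace ℝ (Fin q))}
    (hmom : ∀ j, Integrable (fun t : EuclideanSpace ℝ (Fin q) => t j ^ 2) ν) :
    MemLp (fun t : EuclideanSpace ℝ (Fin q) => 2 * (q * ∑ i, |t i|)) 2 ν := by
  have h : ∀ i, MemLp (fun t : EuclideanSpace ℝ (Fin q) => |t i|) 2 ν := fun i =>
    ((memLp_two_iff_integrable_sq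
      (EuclideanSpace.proj (𝕜 := ℝ) i).continuous.aestronglyMeasurable).2 (hmom i)).abs
  have hs : MemLp (fun t : EuclideanSpace ℝ (Fin q) => ∑ i, |t i|) 2 ν :=
    memLp_finsetSum _ fun i _ => h i
  exact (hs.const_mul (q : ℝ)).const_mul (2 : ℝ)

theorem integrable_m1_apply {ν : Measure (EuclideanSpace ℝ (Fin q))} [IsFiniteMeasure ν]
    (hmom : ∀ j, Integrable (fun t : EuclideanSpace ℝ (Fin q) => t j ^ 2) ν) (j : Fin q) :
    Integrable (fun t => m1 F t j) ν :=
  ((memLp_sum_abs hmom).integrable one_le_two).mono' (measurable_m1 j).aestronglyMeasurable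
    (Eventually.of_forall fun t => abs_m1_le t j)

theorem integrable_m1 {ν : Measure (EuclideanSpace ℝ (Fin q))} [IsFiniteMeasure ν]
    (hmom : ∀ j, Integrable (fun t : EuclideanSpace ℝ (Fin q) => t j ^ 2) ν) :
    Integrable (m1 F) ν :=
  Integrable.of_eval_piLp fun j => integrable_m1_apply hmom j

theorem integrable_m2 {ν : Measure (EuclideanSpace ℝ (Fin q))} [IsFiniteMeasure ν]
    (hmom : ∀ j, Integrable (fun t : EuclideanSpace ℝ (Fin q) => t j ^ 2) ν) (j l : Fin q) :
    Integrable (fun t => m2 F t j l) ν :=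
  (memLp_sum_abs hmom).integrable_sq.mono' (measurable_m2 j l).aestronglyMeasurable
    (Eventually.of_forall fun t => abs_m2_le t j l)

theorem memLp_iwasawa
    (hmom : ∀ j, Integrable (fun t : EuclideanSpace ℝ (Fin q) => t j ^ 2) (νG.map logSing))
    (j : Fin q) : MemLp (fun g => iwasawa g j) 2 νG := by
  have h := (memLp_sum_abs hmom).comp_of_map measurable_logSing.aemeasurable
  refine h.of_le ?_ (Eventually.of_forall fun g => ?_)
  · exact ((EuclideanSpace.proj j).continuous.comp continuous_iwasawa).aestronglyMeasurable
  · exact (abs_iwasawa_le g j).trans (le_abs_self _)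

/-- Averaging over unitary right factors does not change integrals against `νG`, and the average of
`iwasawa` is `m1` at `logSing`. The covariance is treated alike. -/
theorem dispersion_apply
    (hmom : ∀ j, Integrable (fun t : EuclideanSpace ℝ (Fin q) => t j ^ 2) (νG.map logSing))
    (hinv : IsRightInvariant νG) (j : Fin q) :
    dispersion F (νG.map logSing) j = ∫ g, iwasawa g j ∂νG := by
  have : IsProbabilityMeasure (νG.map logSing) :=
    Measure.isProbabilityMeasure_map measurable_logSing.aemeasurable
  rw [← hinv.integral_integral_mul ((memLp_iwasawa hmom j).integrable one_le_two), dispersion]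
  have h1 : ∫ t, m1 F t j ∂(νG.map logSing) = (∫ t, m1 F t ∂(νG.map logSing)) j :=
    (EuclideanSpace.proj (𝕜 := ℝ) j).integral_comp_comm (integrable_m1 (F := F) hmom)
  rw [← h1, integral_map measurable_logSing.aemeasurable (measurable_m1 j).aestronglyMeasurable]
  simp only [m1_logSing]

theorem modCov_apply
    (hmom : ∀ j, Integrable (fun t : EuclideanSpace ℝ (Fin q) => t j ^ 2) (νG.map logSing))
    (hinv : IsRightInvariant νG) (j l : Fin q) :
    modCov F (νG.map logSing) j l = ∫ g, iwasawa g j * iwasawa g l ∂νG -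
      (∫ g, iwasawa g j ∂νG) * ∫ g, iwasawa g l ∂νG := by
  have hjl : Integrable (fun g => iwasawa g j * iwasawa g l) νG :=
    (memLp_iwasawa hmom j).integrable_mul (memLp_iwasawa hmom l)
  have h2 : ∫ t, m2 F t j l ∂(νG.map logSing) = ∫ g, iwasawa g j * iwasawa g l ∂νG := by
    rw [← hinv.integral_integral_mul hjl,
      integral_map measurable_logSing.aemeasurable (measurable_m2 j l).aestronglyMeasurable]
    simp only [m2_logSing]
  rw [modCov, Matrix.of_apply, dispersion_apply hmom hinv, dispersion_apply hmom hinv, h2]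

theorem integral_iwasawa
    (hmom : ∀ j, Integrable (fun t : EuclideanSpace ℝ (Fin q) => t j ^ 2) (νG.map logSing))
    (hinv : IsRightInvariant νG) :
    ∫ g, iwasawa g ∂νG = dispersion F (νG.map logSing) := by
  ext j
  rw [dispersion_apply hmom hinv]
  exact ((EuclideanSpace.proj (𝕜 := ℝ) j).integral_comp_comm (μ := νG) (φ := iwasawa)
    (Integrable.of_eval_piLp fun j => (memLp_iwasawa hmom j).integrable one_le_two)).symm

theorem inner_eq_sum (x y : EuclideanSpace ℝ (Fin q)) : inner ℝ x y = ∑ j, x j * y j := by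
  rw [PiLp.inner_apply]
  exact Finset.sum_congr rfl fun j _ => mul_comm _ _

theorem memLp_inner_iwasawa
    (hmom : ∀ j, Integrable (fun t : EuclideanSpace ℝ (Fin q) => t j ^ 2) (νG.map logSing))
    (c t : EuclideanSpace ℝ (Fin q)) :
    MemLp (fun g => (inner ℝ (iwasawa g - c) t : ℝ)) 2 νG := by
  simp only [inner_eq_sum]
  refine memLp_finsetSum _ fun j _ => ?_
  exact ((memLp_iwasawa hmom j).sub (memLp_const (c j))).mul_const (t j)

theorem integral_inner_iwasawa_sub
    (hmom : ∀ j, Integrable (fun t : EuclideanSpace ℝ (Fin q) => t j ^ 2) (νG.map logSing))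
    (hinv : IsRightInvariant νG) (t : EuclideanSpace ℝ (Fin q)) :
    ∫ g, (inner ℝ (iwasawa g - dispersion F (νG.map logSing)) t : ℝ) ∂νG = 0 := by
  have hiw : Integrable (iwasawa : GL (Fin q) F → EuclideanSpace ℝ (Fin q)) νG :=
    Integrable.of_eval_piLp fun j => (memLp_iwasawa hmom j).integrable one_le_two
  simp only [fun x => real_inner_comm t (x : EuclideanSpace ℝ (Fin q))]
  have hsub : Integrable (fun g => iwasawa g - dispersion F (νG.map logSing)) νG :=
    hiw.sub (integrable_const _)
  rw [integral_inner hsub, integral_sub hiw (integrable_const _),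
    integral_iwasawa hmom hinv]
  simp

theorem integral_inner_iwasawa_sub_sq
    (hmom : ∀ j, Integrable (fun t : EuclideanSpace ℝ (Fin q) => t j ^ 2) (νG.map logSing))
    (hinv : IsRightInvariant νG) (t : EuclideanSpace ℝ (Fin q)) :
    ∫ g, (inner ℝ (iwasawa g - dispersion F (νG.map logSing)) t : ℝ) ^ 2 ∂νG =
      t ⬝ᵥ modCov F (νG.map logSing) *ᵥ t := by
  set m := dispersion F (νG.map logSing) with hm
  have hsub : ∀ j, MemLp (fun g => iwasawa g j - m j) 2 νG := fun j =>
    (memLp_iwasawa hmom j).sub (memLp_const (m j))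
  have hprod : ∀ j l, ∫ g, (iwasawa g j - m j) * (iwasawa g l - m l) ∂νG =
      modCov F (νG.map logSing) j l := by
    intro j l
    have hj := (memLp_iwasawa hmom j).integrable one_le_two
    have hl := (memLp_iwasawa hmom l).integrable one_le_two
    have hjl : Integrable (fun g => iwasawa g j * iwasawa g l) νG :=
      (memLp_iwasawa hmom j).integrable_mul (memLp_iwasawa hmom l)
    have e : ∀ g : GL (Fin q) F, (iwasawa g j - m j) * (iwasawa g l - m l) =
        iwasawa g j * iwasawa g l - m l * iwasawa g j - m j * iwasawa g l + m j * m l :=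
      fun g => by ring
    simp only [e]
    have i1 : Integrable (fun g => iwasawa g j * iwasawa g l - m l * iwasawa g j) νG :=
      hjl.sub (hj.const_mul _)
    have i2 : Integrable (fun g => iwasawa g j * iwasawa g l - m l * iwasawa g j -
        m j * iwasawa g l) νG := i1.sub (hl.const_mul _)
    rw [integral_add i2 (integrable_const _),
      integral_sub i1 (hl.const_mul _), integral_sub hjl (hj.const_mul _),
      integral_const_mul, integral_const_mul, modCov_apply hmom hinv, hm,
      dispersion_apply hmom hinv, dispersion_apply hmom hinv]
    simp
    ring
  have e : ∀ g : GL (Fin q) F, (inner ℝ (iwasawa g - m) t : ℝ) ^ 2 =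
      ∑ j, ∑ l, (t j * t l) * ((iwasawa g j - m j) * (iwasawa g l - m l)) := by
    intro g
    rw [inner_eq_sum, sq, Finset.sum_mul_sum]
    refine Finset.sum_congr rfl fun j _ => Finset.sum_congr rfl fun l _ => ?_
    simp only [PiLp.sub_apply]
    ring
  simp only [e]
  have hi : ∀ j l, Integrable (fun g => (t j * t l) *
      ((iwasawa g j - m j) * (iwasawa g l - m l))) νG := fun j l =>
    ((hsub j).integrable_mul (hsub l)).const_mul _
  rw [integral_finsetSum _ fun j _ => integrable_finsetSum _ fun l _ => hi j l]
  simp only [dotProduct, mulVec, Finset.mul_sum]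
  refine Finset.sum_congr rfl fun j _ => ?_
  rw [integral_finsetSum _ fun l _ => hi j l]
  refine Finset.sum_congr rfl fun l _ => ?_
  rw [integral_const_mul, hprod]
  ring

/-- The quadratic form at `x` is the variance of the inner product of `iwasawa` with `x`. -/
theorem posSemidef_modCov
    (hmom : ∀ j, Integrable (fun t : EuclideanSpace ℝ (Fin q) => t j ^ 2) (νG.map logSing))
    (hinv : IsRightInvariant νG) : (modCov F (νG.map logSing)).PosSemidef := by
  refine Matrix.PosSemidef.of_dotProduct_mulVec_nonneg ?_ fun x => ?_
  · ext j l
    rw [conjTranspose_apply, star_trivial, modCov_apply hmom hinv, modCov_apply hmom hinv]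
    simp only [mul_comm]
  · have h := integral_inner_iwasawa_sub_sq hmom hinv (WithLp.toLp 2 x)
    rw [star_trivial]
    calc (0 : ℝ) ≤ ∫ g, (inner ℝ (iwasawa g - dispersion F (νG.map logSing))
          (WithLp.toLp 2 x) : ℝ) ^ 2 ∂νG := integral_nonneg fun _ => sq_nonneg _
      _ = _ := h

end MomentsOfLaw

/-! ### The central limit theorem for the Iwasawa projection -/

section CentralLimit

variable {F : Type*} [NormedDivisionRing F] [NormedAlgebra ℝ F] [StarRing F] [CStarRing F]
  [FiniteDimensional ℝ F] [hF : Fact (IsRealComplexOrQuaternion F)] {q : ℕ}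
  {νG : Measure (GL (Fin q) F)} {Ω : Type*} [MeasurableSpace Ω]
  {P : Measure Ω} [IsProbabilityMeasure P] {X : ℕ → Ω → GL (Fin q) F}

theorem charFun_normalized_walk (hX : ∀ k, Measurable (X k)) (hind : iIndepFun X P)
    (hlaw : ∀ k, P.map (X k) = νG) (hinv : IsRightInvariant νG) {k : ℕ} (hk : 1 ≤ k) (s : ℝ)
    (m t : EuclideanSpace ℝ (Fin q)) :
    charFun (P.map fun ω => s • (iwasawa (walk X k ω) - (k : ℝ) • m)) t =
      charFun (νG.map fun g => (inner ℝ (iwasawa g - m) t : ℝ)) s ^ k := by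
  obtain ⟨n, rfl⟩ : ∃ n, k = n + 1 := ⟨k - 1, by omega⟩
  have hH : Measurable (iwasawa : GL (Fin q) F → EuclideanSpace ℝ (Fin q)) :=
    continuous_iwasawa.measurable
  have hY : AEMeasurable (fun ω => iwasawa (walk X (n + 1) ω)) P :=
    (hH.comp (measurable_walk hX _)).aemeasurable
  have hmap : P.map (fun ω => iwasawa (walk X (n + 1) ω)) =
      (P.map (walk X (n + 1))).map iwasawa :=
    (Measure.map_map hH (measurable_walk hX _)).symm
  rw [charFun_map_sub_smul hY, charFun_map_inner_sub hH.aemeasurable, hmap,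
    charFun_map_iwasawa_walk hX hind hlaw hinv, mul_pow, ← Complex.exp_nat_mul]
  congr 2
  rw [← smul_neg, real_inner_smul_left]
  push_cast
  ring

theorem tendstoInDistribution_iwasawa_walk (hX : ∀ k, Measurable (X k)) (hind : iIndepFun X P)
    (hlaw : ∀ k, P.map (X k) = νG) (hinv : IsRightInvariant νG)
    (hmom : ∀ j, Integrable (fun t : EuclideanSpace ℝ (Fin q) => t j ^ 2) (νG.map logSing)) :
    TendstoInDistribution (fun (k : ℕ) ω => (√(k : ℝ))⁻¹ •
        (iwasawa (walk X k ω) - (k : ℝ) • dispersion F (νG.map logSing)))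
      atTop id (fun _ => P) (multivariateGaussian 0 (modCov F (νG.map logSing))) where
  forall_aemeasurable k := by
    have hH : Measurable (iwasawa : GL (Fin q) F → EuclideanSpace ℝ (Fin q)) :=
      continuous_iwasawa.measurable
    have h : Measurable fun ω => iwasawa (walk X k ω) := hH.comp (measurable_walk hX k)
    exact ((h.sub_const ((k : ℝ) • dispersion F (νG.map logSing))).const_smul
      (√(k : ℝ))⁻¹).aemeasurable
  tendsto := by
    have : IsProbabilityMeasure νG := by
      rw [← hlaw 0]; exact Measure.isProbabilityMeasure_map (hX 0).aemeasurable
    -- By Lévy's theorem it suffices to fix `t` and apply the scalar limit to the projection of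
    -- `iwasawa` on `t`.
    refine ProbabilityMeasure.tendsto_iff_tendsto_charFun.2 fun t => ?_
    have hlim := tendsto_charFun_inv_sqrt_pow (memLp_inner_iwasawa hmom
      (dispersion F (νG.map logSing)) t) (integral_inner_iwasawa_sub hmom hinv t)
    rw [integral_inner_iwasawa_sub_sq hmom hinv] at hlim
    have hG : charFun ((multivariateGaussian 0 (modCov F (νG.map logSing))).map id) t =
        Complex.exp (-((t ⬝ᵥ modCov F (νG.map logSing) *ᵥ t : ℝ) : ℂ) / 2) := by
      rw [Measure.map_id, charFun_multivariateGaussian (posSemidef_modCov hmom hinv)]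
      simp [neg_div]
    simp only [ProbabilityMeasure.coe_mk, hG]
    refine hlim.congr' ?_
    filter_upwards [eventually_ge_atTop 1] with k hk
    exact (charFun_normalized_walk hX hind hlaw hinv hk _ _ t).symm

end CentralLimit

end BiinvariantWalk

end

theorem theorem2p5 {F : Type*} [NormedDivisionRing F] [NormedAlgebra ℝ F] [StarRing F]
    [CStarRing F] [FiniteDimensional ℝ F] (hF : IsRealComplexOrQuaternion F)
    (q : ℕ) (hq : 2 ≤ q)
    {Ω : Type*} [MeasurableSpace Ω] (P : Measure Ω) [IsProbabilityMeasure P]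
    (νG : Measure (GL (Fin q) F)) (hbi : IsBiinvariant νG)
    (X : ℕ → Ω → GL (Fin q) F) (hX : ∀ k, Measurable (X k))
    (hlaw : ∀ k, P.map (X k) = νG) (hind : iIndepFun X P)
    (ν : Measure (EuclideanSpace ℝ (Fin q))) (hν : ν = νG.map logSing)
    (hmom : ∀ j, Integrable (fun t : EuclideanSpace ℝ (Fin q) => t j ^ 2) ν) :
    Integrable (m1 F) ν ∧ (∀ j l, Integrable (fun t => m2 F t j l) ν) ∧
    (modCov F ν).PosSemidef ∧
    TendstoInDistribution
      (fun (k : ℕ) ω => (√(k : ℝ))⁻¹ • (logSing (walk X k ω) - (k : ℝ) • dispersion F ν))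
      atTop id (fun _ => P) (multivariateGaussian 0 (modCov F ν)) := by
  have : Fact (IsRealComplexOrQuaternion F) := ⟨hF⟩
  subst hν
  have hprob : IsProbabilityMeasure νG := by
    rw [← hlaw 0]; exact Measure.isProbabilityMeasure_map (hX 0).aemeasurable
  have hprob' : IsProbabilityMeasure (νG.map logSing) :=
    Measure.isProbabilityMeasure_map measurable_logSing.aemeasurable
  have hinv : IsRightInvariant νG := fun u => (hbi u).2
  refine ⟨integrable_m1 hmom, integrable_m2 hmom, posSemidef_modCov hmom hinv, ?_⟩
  -- Slutsky's lemma: the centerings cancel in the difference, leaving only the defect between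
  -- `logSing` and `iwasawa`.
  refine tendstoInDistribution_of_tendstoInMeasure_sub _ id
    (tendstoInDistribution_iwasawa_walk hX hind hlaw hinv hmom) ?_ fun k => ?_
  · have e : ((fun (k : ℕ) ω => (√(k : ℝ))⁻¹ •
          (logSing (walk X k ω) - (k : ℝ) • dispersion F (νG.map logSing))) -
        fun (k : ℕ) ω => (√(k : ℝ))⁻¹ •
          (iwasawa (walk X k ω) - (k : ℝ) • dispersion F (νG.map logSing))) =
        fun (k : ℕ) ω => (√(k : ℝ))⁻¹ • (logSing (walk X k ω) - iwasawa (walk X k ω)) := by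
      funext k ω
      simp only [Pi.sub_apply, ← smul_sub, sub_sub_sub_cancel_right]
    rw [e]
    exact tendstoInMeasure_logSing_sub_iwasawa hX hind hlaw hinv
  · have h : Measurable fun ω => logSing (walk X k ω) :=
      measurable_logSing.comp (measurable_walk hX k)
    exact ((h.sub_const ((k : ℝ) • dispersion F (νG.map logSing))).const_smul
      (√(k : ℝ))⁻¹).aemeasurable
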